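/- **Model.** A finite set $\Pi$ of $n$ processes operates in synchronous rounds $r=1,2,\dots$. In round $r$ every process broadcasts its entire state, which records everything it has learned so far; the message of $p$ reaches $q$ iff $(p\to q)$ is an edge of the communication graph $\mathcal G^r$, a digraph on $\Pi$ with all self-loops; then every process performs a deterministic state transition. $p^r$ is the state of $p$ at the end of round $r$ ($p^0$ is the initial state), and $\mathrm{Prop}_p^r,\mathrm{locked}_p^r$ are the values of its variables in $p^r$. A *root component* of a digraph is the nonempty vertex set of a strongly connected component that no edge enters from outside. $\mathcal G$ is *rooted* if it has exactly one root component, $\mathrm{Root}(\mathcal G)$. A nonempty sequence of graphs is *$R$-rooted* if each of its graphs is rooted with root component $R$. The *causal past* $\mathrm{CP}_p(a,b)$ is $\{p\}$ for $a=b$; for $a<b$ it is the in-neighbourhood of $p$ in $\mathcal G^{a+1}\circ\cdots\circ\mathcal G^{b}$, where $(u,w)\in\mathcal G\circ\mathcal H$ iff $(u,u')\in\mathcal G$ and $(u',w)\in\mathcal H$ for some $u'$. The state $q^s$ is known to $p$ in round $r$ iff $q\in\mathrm{CP}_p(s,r)$. **Message adversary.** For $D\ge 1$, $\Diamond\mathrm{STABLE}_D(x)$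 is the set of all infinite sequences $(\mathcal G^r)_{r\ge1}$ of communication graphs such that (i) every $\mathcal G^r$ is rooted; (ii) for some $R$, some at least $x$ consecutive graphs form an $R$-rooted sequence; (iii) whenever $\mathcal G^{a+1},\dots,\mathcal G^{a+D}$ is $R$-rooted, $R\subseteq \mathrm{CP}_p(a,a+D)$ for every $p\in\Pi$. **Consensus.** Every process $p$ has an input $x_p$ from a totally ordered set. An algorithm solves consensus under a message adversary if for all inputs and all graph sequences of the adversary: every process eventually decides, its decision is irrevocable, all decisions are equal, and every decision is the input of some process. **Root estimates.** $\mathrm{Root}_p^r(s)=R$ if $s\ge1$ and, in round $r$, $p$ knows the in-neighbourhoods in $\mathcal G^s$ of all members of $R$ (that is, it knows $q^s$ for all $q\in R$) and $R$ is a root component of the graph formed by the edges of $\mathcal G^s$ known to $p$; if there is no such $R$, then $\mathrm{Root}_p^r(s)=\bot$. **Algorithm** (parameters $D,N$; code of process $p$). Initially $\mathrm{Prop}=x_p$, $\mathrm{locked}=\mathrm{true}$, $\ell=1$, $Q=\emptyset$, and $p$ is undecided. Put $\max\emptyset=0$ and $W=N(D+2N)$. In the round $r$ computation, first let - $T=\{\mathrm{Root}_p^r(i):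 \max(\max Q,\ell)-D\le i\le r-D\}$ (where $\bot$ counts as an element); - $S$ be the set of the states $q^s$ known to $p$ with $q\in \mathrm{CP}_p(r-N,r)$ and $r-N\le s<r$; - $S'=\{\mathrm{Prop}_q^s: q^s\in S,\ \mathrm{locked}_q^s=\mathrm{true}\}$; - $S''$ be the set of the states $q^s$ known to $p$ with $q\in \mathrm{CP}_p(r-W,r)$ and $r-(D+2N)^2\le s<r$; where negative rounds in the bounds for $S$ and $S''$ are read as $0$. Then perform in this order: 1. If $R:=\mathrm{Root}_p^r(r-D)\neq\bot$, let $y=\max_{q\in R}\mathrm{Prop}_q^{r-D}$. If $\mathrm{locked}=\mathrm{false}$, or $y\ne\mathrm{Prop}$ and $|T|>1$, set $\mathrm{Prop}\gets y$, $\mathrm{locked}\gets\mathrm{true}$, $\ell\gets r$; otherwise, if $y=\mathrm{Prop}$, add $r$ to $Q$. 2. If $r\ge \ell+N$ and some $q^s\in S$ has $\mathrm{locked}_q^s=\mathrm{false}$ or $\mathrm{Prop}_q^s\neq\mathrm{Prop}$, then remove from $Q$ all $r'$ with $r'\le s$ for some such $q^s$; afterwards, if $Q\ne\emptyset$ set $\ell\gets\min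 Q$, else set $\mathrm{locked}\gets\mathrm{false}$. 3. If $r\ge\ell+2N$ and $S'=\{y\}$ for a single $y\neq\mathrm{Prop}$, set $\mathrm{Prop}\gets y$. 4. If $p$ has not decided yet, $r\ge \ell+W$, and all $q^s\in S''$ have $\mathrm{locked}_q^s=\mathrm{true}$ and $\mathrm{Prop}_q^s=\mathrm{Prop}$, then decide $\mathrm{Prop}$. **Theorem.** Let $D\ge1$ and $N\ge n$. Then this algorithm, with the parameters $D$ and $N$, solves consensus under the message adversary $\Diamond\mathrm{STABLE}_D(D+1)$. -/

import Mathlib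

universe u v

/-! ### Communication graphs, root components, causal past

Processes are the elements of a finite type `P`.  A graph sequence is a function
`σ : ℕ → Digraph P`; `σ r` is the communication graph of round `r`, for `r = 1, 2, …`
(the value `σ 0` is never used: there is no round `0`). -/

/-- `R` is a root component of `G`: it is (nonempty and) the vertex set of a strongly connected
component of `G`, and no edge of `G` enters `R` from outside. -/
def IsRootComponent {P : Type u} (G : Digraph P) (R : Finset P) : Prop :=
  R.Nonempty ∧
  (∀ p ∈ R, ∀ q, q ∈ R ↔ Relation.ReflTransGen G.Adj p q ∧ Relation.ReflTransGen G.Adj q p) ∧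
  (∀ p, ∀ q ∈ R, G.Adj p q → p ∈ R)

/-- `G` is rooted, and its single root component is `R`. -/
def HasRoot {P : Type u} (G : Digraph P) (R : Finset P) : Prop :=
  IsRootComponent G R ∧ ∀ R', IsRootComponent G R' → R' = R

/-- `G` is rooted: it has a single root component. -/
def IsRooted {P : Type u} (G : Digraph P) : Prop := ∃ R, HasRoot G R

/-- The graphs of the rounds `a, …, b` have the stable root component `R`. -/
def IsRootedSeq {P : Type u} (σ : ℕ → Digraph P) (a b : ℕ) (R : Finset P) : Prop :=
  a ≤ b ∧ ∀ r, a ≤ r → r ≤ b → HasRoot (σ r) R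

/-- The compound graph `G ∘ H`. -/
def compound {P : Type u} (G H : Digraph P) : Digraph P where
  Adj p q := ∃ p', G.Adj p p' ∧ H.Adj p' q

/-- The compound graph `σ (a + 1) ∘ ⋯ ∘ σ (a + k)` (only self-loops if `k = 0`). -/
def compoundSeq {P : Type u} (σ : ℕ → Digraph P) (a : ℕ) : ℕ → Digraph P
  | 0 => { Adj := fun p q => p = q }
  | k + 1 => compound (compoundSeq σ a k) (σ (a + k + 1))

/-- The causal past of `p` from the end of round `b` down to the end of round `a` (`a ≤ b`). -/
def CausalPast {P : Type u} (σ : ℕ → Digraph P) (p : P) (a b : ℕ) : Set P :=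
  {q | (compoundSeq σ a (b - a)).Adj q p}

/-! ### Message adversaries -/

/-- A message adversary is identified with its set of admissible graph sequences. -/
abbrev MessageAdversary (P : Type u) := Set (ℕ → Digraph P)

/-- The unrestricted message adversary: all sequences of communication graphs.  Every process
always receives its own message, so every communication graph contains all self-loops. -/
def Unrestricted (P : Type u) : MessageAdversary P :=
  {σ | ∀ r, 1 ≤ r → ∀ p, (σ r).Adj p p}

/-- `ROOTED`: every communication graph is rooted. -/
def ROOTED (P : Type u) : MessageAdversary P :=
  {σ | σ ∈ Unrestricted P ∧ ∀ r, 1 ≤ r → IsRooted (σ r)}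

/-- `◇STABILITY(x)`: some (nonempty) subsequence of at least `x` consecutive graphs has a stable
root component. -/
def STABILITY (P : Type u) (x : ℕ) : MessageAdversary P :=
  {σ | σ ∈ Unrestricted P ∧
    ∃ (R : Finset P) (a b : ℕ), 1 ≤ a ∧ x ≤ b - a + 1 ∧ IsRootedSeq σ a b R}

/-- `DIAM(D)`, for `1 ≤ D`: after any `D` consecutive rounds `a + 1, …, a + D` with stable root
component `R`, every process has all members of `R` in its causal past down to round `a`. -/
def DIAM (P : Type u) (D : ℕ) : MessageAdversary P :=
  {σ | σ ∈ Unrestricted P ∧ ∀ (a : ℕ) (R : Finset P), IsRootedSeq σ (a + 1) (a + D) R →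
    ∀ p : P, ∀ q ∈ R, q ∈ CausalPast σ p a (a + D)}

/-- `◇STABLE_D(x) = ROOTED ∩ ◇STABILITY(x) ∩ DIAM(D)`. -/
def STABLE (P : Type u) (D x : ℕ) : MessageAdversary P :=
  ROOTED P ∩ STABILITY P x ∩ DIAM P D

/-! ### Deterministic full-information algorithms and consensus -/

/-- A deterministic synchronous algorithm for the processes `P` and input values `V`, in which
every process broadcasts its entire state in every round.  `step p st inbox` is the new state of
`p`, where `st` is its old state and `inbox q` is the message received from `q`, if any;
`decision` is the value of the output variable. -/
structure Algorithm (P : Type u) (V : Type v) where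
  State : Type (max u v)
  init : P → V → State
  step : P → State → (P → Option State) → State
  decision : State → Option V

open Classical in
/-- `A.config x σ r p` is the state of `p` at the end of round `r` in the execution of `A` with
inputs `x` under the graph sequence `σ`. -/
noncomputable def Algorithm.config {P : Type u} {V : Type v} (A : Algorithm P V)
    (x : P → V) (σ : ℕ → Digraph P) : ℕ → P → A.State
  | 0 => fun p => A.init p (x p)
  | r + 1 => fun p => A.step p (A.config x σ r p)
      (fun q => if (σ (r + 1)).Adj q p then some (A.config x σ r q) else none)

/-- `A` solves consensus under the message adversary `MA`: in every admissible execution,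
every process eventually decides, decisions are irrevocable, no two decisions differ, and every
decision is the input of some process. -/
def Algorithm.SolvesConsensus {P : Type u} {V : Type v} (A : Algorithm P V)
    (MA : MessageAdversary P) : Prop :=
  ∀ (x : P → V) (σ : ℕ → Digraph P), σ ∈ MA →
    (∀ p, ∃ r y, A.decision (A.config x σ r p) = some y) ∧
    (∀ p r r' y, r ≤ r' → A.decision (A.config x σ r p) = some y →
      A.decision (A.config x σ r' p) = some y) ∧
    (∀ p q r r' y z, A.decision (A.config x σ r p) = some y →
      A.decision (A.config x σ r' q) = some z → y = z) ∧
    (∀ p r y, A.decision (A.config x σ r p) = some y → ∃ q, x q = y)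

/-! ### The consensus algorithm -/

namespace ConsensusAlg

/-- The variables of a process (`decision` is the output variable, initially undefined). -/
structure Vars (V : Type v) where
  proposal : V
  locked : Bool
  lockRound : ℕ
  queue : Finset ℕ
  decision : Option V

/-- What other processes may learn about the round `s` state of a process: its variables at the
end of round `s`, and its in-neighbourhood in the communication graph of round `s`. -/
structure Record (P : Type u) (V : Type v) where
  vars : Vars V
  heard : Finset P

/-- `K s q = some ρ`: the round `s` state `ρ` of process `q` is known. -/
abbrev Knowledge (P : Type u) (V : Type v) := ℕ → P → Option (Record P V)

/-- Local state of a process: the number of the last completed round, the present variables, and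
everything known about the states (its own and those of other processes) of all rounds so far. -/
structure LocalState (P : Type u) (V : Type v) where
  round : ℕ
  vars : Vars V
  know : Knowledge P V

variable {P : Type u} {V : Type v}

open Classical in
/-- The initial state of process `p` with input `x`. -/
noncomputable def initState (p : P) (x : V) : LocalState P V :=
  let w : Vars V := ⟨x, true, 1, ∅, none⟩
  { round := 0
    vars := w
    know := fun s q => if s = 0 ∧ q = p then some ⟨w, ∅⟩ else none }

open Classical in
/-- Everything known from the own old state or from a received message. -/
noncomputable def merge (st : LocalState P V) (inbox : P → Option (LocalState P V)) :
    Knowledge P V := fun s q =>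
  if h : ∃ ρ, st.know s q = some ρ ∨ ∃ u st', inbox u = some st' ∧ st'.know s q = some ρ
  then some h.choose else none

/-- The local approximation of the round `s` communication graph: all edges that are known. -/
def approxGraph (K : Knowledge P V) (s : ℕ) : Digraph P where
  Adj u w := ∃ ρ, K s w = some ρ ∧ u ∈ ρ.heard

/-- `R` is certainly a root component of the round `s` communication graph: the in-neighbourhoods
of all its members are known, and `R` is a root component of the known part of the graph. -/
def IsCertainRoot (K : Knowledge P V) (s : ℕ) (R : Finset P) : Prop :=
  1 ≤ s ∧ (∀ q ∈ R, (K s q).isSome) ∧ IsRootComponent (approxGraph K s) R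

open Classical in
/-- The local estimate of the root component of the round `s` communication graph; `none` stands
for `{⊥}` (unsure), which is also the value for rounds `s < 1`. -/
noncomputable def rootEst (K : Knowledge P V) (s : ℕ) : Option (Finset P) :=
  if h : ∃ R, IsCertainRoot K s R then some h.choose else none

open Classical in
/-- The set `T` of the root estimates for the rounds `i` with
`max (max queue) ℓ - D ≤ i ≤ r - D`, where `max ∅ = 0`.  The estimate for negative `i` would be
`none`, as for `i = 0`; if a negative `i` occurs and `0 ≤ r - D`, then `i = 0` occurs as well. -/
noncomputable def rootsSinceLock (D : ℕ) (K : Knowledge P V) (r : ℕ) (w : Vars V) :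
    Finset (Option (Finset P)) :=
  ((Finset.range (r + 1)).filter
    (fun i => max (w.queue.sup id) w.lockRound ≤ i + D ∧ i + D ≤ r)).image (rootEst K)

/-- The known states `q^s` of round `r` with `q` in the causal past down to round `r - a`
and `s ≥ r - b`. -/
def knownStates (K : Knowledge P V) (r a b : ℕ) : Set (P × ℕ × Vars V) :=
  {t | (K (r - a) t.1).isSome ∧ r - b ≤ t.2.1 ∧
    ∃ ρ, K t.2.1 t.1 = some ρ ∧ ρ.vars = t.2.2}

/-- The proposal recorded in the round `s` state of `q` (the default `d` is never used for
states that are known). -/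
def proposalOf (K : Knowledge P V) (s : ℕ) (d : V) (q : P) : V :=
  (K s q).elim d (fun ρ => ρ.vars.proposal)

open Classical in
/-- The first block: root component detection. -/
noncomputable def detect [LinearOrder V] (D : ℕ) (K : Knowledge P V) (r : ℕ) (w : Vars V) :
    Vars V :=
  match rootEst K (r - D) with
  | none => w
  | some R =>
    if hR : R.Nonempty then
      let y : V := R.sup' hR (proposalOf K (r - D) w.proposal)
      if w.locked = false ∨ (y ≠ w.proposal ∧ 1 < (rootsSinceLock D K r w).card) then
        { w with proposal := y, locked := true, lockRound := r }
      else if y = w.proposal then { w with queue := insert r w.queue }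
      else w
    else w

/-- The rounds `s` of the states `q^s ∈ S` that contradict the present proposal. -/
def evidence (N : ℕ) (K : Knowledge P V) (r : ℕ) (w : Vars V) : Set ℕ :=
  {s | ∃ q z, (q, s, z) ∈ knownStates K r N N ∧ (z.locked = false ∨ w.proposal ≠ z.proposal)}

open Classical in
/-- The second block: search for contradictory evidence since the lock-round. -/
noncomputable def backoff (N : ℕ) (K : Knowledge P V) (r : ℕ) (w : Vars V) : Vars V :=
  if w.lockRound + N ≤ r ∧ (evidence N K r w).Nonempty then
    let Q := w.queue.filter (fun r' => ¬ ∃ s ∈ evidence N K r w, r' ≤ s)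
    if hQ : Q.Nonempty then { w with queue := Q, lockRound := Q.min' hQ }
    else { w with queue := Q, locked := false }
  else w

/-- The set `S'` of the proposals of the locked states of `S`. -/
def lockedProposals (N : ℕ) (K : Knowledge P V) (r : ℕ) : Set V :=
  {y | ∃ q s z, (q, s, z) ∈ knownStates K r N N ∧ z.locked = true ∧ z.proposal = y}

open Classical in
/-- The third block: adopt the only proposal of the locked states. -/
noncomputable def adopt (N : ℕ) (K : Knowledge P V) (r : ℕ) (w : Vars V) : Vars V :=
  if h : w.lockRound + 2 * N ≤ r ∧ ∃ y, lockedProposals N K r = {y} ∧ y ≠ w.proposal then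
    { w with proposal := h.2.choose }
  else w

open Classical in
/-- The last block: decide. -/
noncomputable def decideNow (D N : ℕ) (K : Knowledge P V) (r : ℕ) (w : Vars V) : Vars V :=
  if w.decision = none ∧ w.lockRound + N * (D + 2 * N) ≤ r ∧
      ∀ q s z, (q, s, z) ∈ knownStates K r (N * (D + 2 * N)) ((D + 2 * N) ^ 2) →
        z.locked = true ∧ z.proposal = w.proposal then
    { w with decision := some w.proposal }
  else w

open Classical in
/-- The computation of process `p` in the round after its last completed round. -/
noncomputable def nextState [Fintype P] [LinearOrder V] (D N : ℕ) (p : P) (st : LocalState P V)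
    (inbox : P → Option (LocalState P V)) : LocalState P V :=
  let r := st.round + 1
  let K := merge st inbox
  let w := decideNow D N K r (adopt N K r (backoff N K r (detect D K r st.vars)))
  { round := r
    vars := w
    know := fun s q => if s = r ∧ q = p
      then some ⟨w, Finset.univ.filter (fun u => (inbox u).isSome)⟩ else K s q }

end ConsensusAlg

/-- The consensus algorithm for known `D` and known bound `N` on the number of processes. -/
noncomputable def consensusAlgorithm (P : Type u) [Fintype P] (V : Type v) [LinearOrder V]
    (D N : ℕ) : Algorithm P V where
  State := ConsensusAlg.LocalState P V
  init := ConsensusAlg.initState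
  step := ConsensusAlg.nextState D N
  decision st := st.vars.decision

/-! ### Root components -/

/-! Two facts about rooted graphs drive the proof. The unique root component lies in every nonempty
in-closed set (`HasRoot.subset`). Hence any two processes share a member of their causal pasts after
`N` rounds (`exists_mem_causalPast_inter`): two disjoint pasts cannot both stop growing, as both
would then contain the root.

Termination. Extend a stable period backwards as far as possible, so that it covers rounds `a + 1,
…, a + D + 1`, and let `r₀ = a + D + 1`. By `DIAM`, in round `r₀` every process knows the root of
round `a + 1` and computes the same value `y`. A process with another proposal sees different
estimates for rounds `a` and `a + 1`, so `|T| > 1` and it locks on `y`; the others are locked on `y`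
or queue `r₀` (`isSettled_detect`). This state persists: inside the period `T` is a singleton, later
root values equal `y`, and contradicting evidence is older than `r₀`, so a queued `r₀` survives a
back-off. Eventually the decision window contains only states locked on `y`.

Agreement. When `p` decides `v`, pigeonhole over `N` blocks of `D + 2 * N` rounds gives a block in
which the causal past of `p` is a constant set `C`. No message enters `C` during the block, and its
members are locked on `v` (`IsCore`). Roots in the block lie in `C`, so every confirmation has value
`v`. Everybody hears from `C` within `N` rounds: after `D + N` rounds no process is still locked on
another value (`IsCore.eq_of_locked`), and after `N` more every proposal is `v`
(`IsCore.eq_of_last`), which then persists (`IsCore.eq_of_le`).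

The bridge between code and argument is the invariant `IsConsistent`: a lock round after round `D`
certifies that the proposal was the root value `D` rounds before. -/

/-- A set of vertices that no edge enters from outside. -/
def IsInClosed {P : Type u} (G : Digraph P) (C : Finset P) : Prop :=
  ∀ p, ∀ q ∈ C, G.Adj p q → p ∈ C

theorem IsInClosed.mem_of_reflTransGen {P : Type u} {G : Digraph P} {C : Finset P}
    (hC : IsInClosed G C) {p q : P} (h : Relation.ReflTransGen G.Adj p q) (hq : q ∈ C) :
    p ∈ C := by
  induction h using Relation.ReflTransGen.head_induction_on with
  | refl => exact hq
  | head hab _ ih => exact hC _ _ ih hab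

theorem IsInClosed.reflTransGen_congr {P : Type u} {G H : Digraph P} {C : Finset P}
    (hC : IsInClosed G C) (hGH : ∀ q ∈ C, ∀ p, G.Adj p q → H.Adj p q) {p q : P}
    (h : Relation.ReflTransGen G.Adj p q) (hq : q ∈ C) : Relation.ReflTransGen H.Adj p q := by
  induction h using Relation.ReflTransGen.head_induction_on with
  | refl => exact .refl
  | head hab hbc ih => exact .head (hGH _ (hC.mem_of_reflTransGen hbc hq) _ hab) ih

/-- Being a root component depends only on the edges that enter the set. -/
theorem IsRootComponent.congr {P : Type u} {G H : Digraph P} {R : Finset P}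
    (hGH : ∀ q ∈ R, ∀ p, G.Adj p q ↔ H.Adj p q) (h : IsRootComponent G R) :
    IsRootComponent H R := by
  obtain ⟨hne, hscc, hcl⟩ := h
  have hG : IsInClosed G R := hcl
  have hH : IsInClosed H R := fun p q hq hpq => hcl p q hq ((hGH q hq p).2 hpq)
  refine ⟨hne, fun p hp q => ⟨fun hq => ?_, fun hpq => hH.mem_of_reflTransGen hpq.2 hp⟩, hH⟩
  obtain ⟨h1, h2⟩ := (hscc p hp q).1 hq
  exact ⟨hG.reflTransGen_congr (fun q hq p => (hGH q hq p).1) h1 hq,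
    hG.reflTransGen_congr (fun q hq p => (hGH q hq p).1) h2 hp⟩

/-- Take a vertex `c` of `C` with the fewest ancestors. An ancestor `u` of `c` lies in `C`, and its
ancestors are among those of `c`; minimality makes the two sets equal, so `c` reaches `u`. Thus the
ancestors of `c` form a root component. -/
theorem IsInClosed.exists_isRootComponent {P : Type u} [Fintype P] {G : Digraph P} {C : Finset P}
    (hC : IsInClosed G C) (hne : C.Nonempty) : ∃ R, IsRootComponent G R ∧ R ⊆ C := by
  classical
  let anc : P → Finset P := fun c => Finset.univ.filter (fun u => Relation.ReflTransGen G.Adj u c)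
  obtain ⟨c, hc, hmin⟩ := Finset.exists_min_image C (fun c => (anc c).card) hne
  have hmem : ∀ u w, u ∈ anc w ↔ Relation.ReflTransGen G.Adj u w := by simp [anc]
  have hback : ∀ u, Relation.ReflTransGen G.Adj u c → Relation.ReflTransGen G.Adj c u := by
    intro u hu
    have hsub : anc u ⊆ anc c := fun z hz => (hmem _ _).2 (((hmem _ _).1 hz).trans hu)
    have := Finset.eq_of_subset_of_card_le hsub (hmin u (hC.mem_of_reflTransGen hu hc))
    exact (hmem _ _).1 (this ▸ (hmem c c).2 .refl)
  refine ⟨anc c, ⟨⟨c, (hmem _ _).2 .refl⟩, fun p hp q => ?_, fun p q hq hpq => ?_⟩,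
    fun u hu => hC.mem_of_reflTransGen ((hmem _ _).1 hu) hc⟩
  · rw [hmem] at hp ⊢
    exact ⟨fun hq => ⟨hp.trans (hback q hq), hq.trans (hback p hp)⟩, fun h => h.2.trans hp⟩
  · rw [hmem] at hq ⊢
    exact .head hpq hq

theorem HasRoot.subset {P : Type u} [Fintype P] {G : Digraph P} {R C : Finset P}
    (h : HasRoot G R) (hC : IsInClosed G C) (hne : C.Nonempty) : R ⊆ C := by
  obtain ⟨R', hR', hsub⟩ := hC.exists_isRootComponent hne
  exact h.2 R' hR' ▸ hsub

theorem HasRoot.unique {P : Type u} {G : Digraph P} {R R' : Finset P}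
    (h : HasRoot G R) (h' : HasRoot G R') : R = R' := h'.2 R h.1

/-! ### Causal pasts -/

section CausalPast

variable {P : Type u} {σ : ℕ → Digraph P}

theorem mem_causalPast_self {p q : P} {a : ℕ} : q ∈ CausalPast σ p a a ↔ q = p := by
  simp [CausalPast, compoundSeq]

theorem mem_causalPast_succ {p q : P} {a b : ℕ} (hab : a ≤ b) :
    q ∈ CausalPast σ p a (b + 1) ↔ ∃ u, q ∈ CausalPast σ u a b ∧ (σ (b + 1)).Adj u p := by
  obtain ⟨k, rfl⟩ := Nat.exists_eq_add_of_le hab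
  have h1 : a + k + 1 - a = k + 1 := by omega
  have h2 : a + k - a = k := by omega
  simp [CausalPast, h1, h2, compoundSeq, compound]

theorem causalPast_trans {p u q : P} {a b c : ℕ} (hab : a ≤ b) (hbc : b ≤ c)
    (hq : q ∈ CausalPast σ u a b) (hu : u ∈ CausalPast σ p b c) : q ∈ CausalPast σ p a c := by
  induction c, hbc using Nat.le_induction generalizing p with
  | base => rw [mem_causalPast_self] at hu; exact hu ▸ hq
  | succ c hbc ih =>
    obtain ⟨z, hz, hzp⟩ := (mem_causalPast_succ hbc).1 hu
    exact (mem_causalPast_succ (hab.trans hbc)).2 ⟨z, ih hz, hzp⟩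

theorem mem_causalPast_of_adj {p q : P} {a : ℕ} (h : (σ (a + 1)).Adj q p) :
    q ∈ CausalPast σ p a (a + 1) :=
  (mem_causalPast_succ le_rfl).2 ⟨q, mem_causalPast_self.2 rfl, h⟩

theorem self_mem_causalPast (hσ : σ ∈ Unrestricted P) (p : P) {a b : ℕ} (hab : a ≤ b) :
    p ∈ CausalPast σ p a b := by
  induction b, hab using Nat.le_induction with
  | base => exact mem_causalPast_self.2 rfl
  | succ b hab ih => exact (mem_causalPast_succ hab).2 ⟨p, ih, hσ _ (by omega) p⟩

theorem causalPast_mono (hσ : σ ∈ Unrestricted P) {p q : P} {a b c d : ℕ} (hab : a ≤ b)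
    (hbc : b ≤ c) (hcd : c ≤ d) (hq : q ∈ CausalPast σ p b c) : q ∈ CausalPast σ p a d :=
  causalPast_trans (hab.trans hbc) hcd
    (causalPast_trans hab hbc (self_mem_causalPast hσ q hab) hq) (self_mem_causalPast hσ p hcd)

/-- If the causal past does not grow from round `a + 1` down to round `a`, then it is in-closed. -/
theorem isInClosed_of_causalPast {p : P} {a c : ℕ} {C : Finset P} (hac : a + 1 ≤ c)
    (h1 : ∀ q, q ∈ C → q ∈ CausalPast σ p (a + 1) c)
    (h2 : ∀ q, q ∈ CausalPast σ p a c → q ∈ C) : IsInClosed (σ (a + 1)) C :=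
  fun _ q hq hzq => h2 _ (causalPast_trans (by omega) hac (mem_causalPast_of_adj hzq) (h1 q hq))

/-- The causal past of a member of a set stays within it as long as the set is in-closed. -/
theorem causalPast_subset_of_isInClosed {p : P} {a b : ℕ} {C : Finset P} (hab : a ≤ b)
    (hC : ∀ s, a < s → s ≤ b → IsInClosed (σ s) C) (hp : p ∈ C) {q : P}
    (hq : q ∈ CausalPast σ p a b) : q ∈ C := by
  induction b, hab using Nat.le_induction generalizing p with
  | base => exact (mem_causalPast_self.1 hq) ▸ hp
  | succ b hab ih =>
    obtain ⟨z, hz, hzp⟩ := (mem_causalPast_succ hab).1 hq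
    exact ih (fun s h1 h2 => hC s h1 (by omega)) (hC _ (by omega) le_rfl _ _ hp hzp) hz

/-- In rooted sequences, any two processes have a common member of their causal pasts after as
many rounds as there are processes. -/
theorem exists_mem_causalPast_inter [Fintype P] (hσ : σ ∈ ROOTED P) {N : ℕ}
    (hN : Fintype.card P ≤ N) (p q : P) {r : ℕ} (hr : N ≤ r) :
    ∃ u, u ∈ CausalPast σ p (r - N) r ∧ u ∈ CausalPast σ q (r - N) r := by
  classical
  by_contra! hcon
  let F : P → ℕ → Finset P := fun p k => Finset.univ.filter (fun u => u ∈ CausalPast σ p (r - k) r)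
  have hmem : ∀ p k u, u ∈ F p k ↔ u ∈ CausalPast σ p (r - k) r := by simp [F]
  have hmono : ∀ p k l, k ≤ l → F p k ⊆ F p l := fun p k l hkl u hu =>
    (hmem _ _ _).2 (causalPast_mono hσ.1 (by omega) (by omega) le_rfl ((hmem _ _ _).1 hu))
  have hself : ∀ p k, p ∈ F p k := fun p k =>
    (hmem _ _ _).2 (self_mem_causalPast hσ.1 p (by omega))
  have hdisj : ∀ k ≤ N, Disjoint (F p k) (F q k) := by
    intro k hk
    rw [Finset.disjoint_left]
    intro u h1 h2
    exact hcon u ((hmem _ _ _).1 (hmono p k N hk h1)) ((hmem _ _ _).1 (hmono q k N hk h2))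
  -- While the pasts are disjoint, their total size grows in each round backwards: otherwise both
  -- are in-closed in the same graph and both contain its root. At `k = N` this exceeds the number
  -- of processes.
  have hgrow : ∀ k ≤ N, k + 2 ≤ (F p k).card + (F q k).card := by
    intro k
    induction k with
    | zero =>
      intro _
      have h1 := Finset.card_pos.2 ⟨p, hself p 0⟩
      have h2 := Finset.card_pos.2 ⟨q, hself q 0⟩
      omega
    | succ k ih =>
      intro hk
      have h0 := ih (by omega)
      have h1 := Finset.card_le_card (hmono p k (k + 1) (by omega))
      have h2 := Finset.card_le_card (hmono q k (k + 1) (by omega))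
      by_contra hlt
      have e1 := Finset.eq_of_subset_of_card_le (hmono p k (k + 1) (by omega)) (by omega)
      have e2 := Finset.eq_of_subset_of_card_le (hmono q k (k + 1) (by omega)) (by omega)
      have hcl : ∀ p, F p k = F p (k + 1) → IsInClosed (σ (r - k)) (F p k) := by
        intro p e
        have hrk : r - k = r - (k + 1) + 1 := by omega
        rw [hrk]
        refine isInClosed_of_causalPast (p := p) (c := r) (by omega) (fun u hu => ?_)
          (fun u hu => ?_)
        · rw [← hrk]; exact (hmem _ _ _).1 hu
        · rw [e]; exact (hmem _ _ _).2 hu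
      obtain ⟨R, hR⟩ := hσ.2 (r - k) (by omega)
      obtain ⟨z, hz⟩ := hR.1.1
      exact Finset.disjoint_left.1 (hdisj k (by omega))
        (hR.subset (hcl p e1) ⟨p, hself p k⟩ hz) (hR.subset (hcl q e2) ⟨q, hself q k⟩ hz)
  have h1 := hgrow N le_rfl
  rw [← Finset.card_union_of_disjoint (hdisj N le_rfl)] at h1
  have := Finset.card_le_univ (F p N ∪ F q N)
  omega

/-- Among `N * M` rounds, there are `M` consecutive ones in which the causal past of `p` does not
change. -/
theorem exists_constant_causalPast [Fintype P] (hσ : σ ∈ Unrestricted P) {N M : ℕ}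
    (hN : Fintype.card P ≤ N) (p : P) {r : ℕ} (hr : N * M ≤ r) :
    ∃ (a : ℕ) (C : Finset P), C.Nonempty ∧ r - N * M ≤ a ∧ a + M ≤ r ∧
      (∀ s, a < s → s ≤ a + M → IsInClosed (σ s) C) ∧
      ∀ s, a ≤ s → s ≤ a + M → ∀ q ∈ C, q ∈ CausalPast σ p s r := by
  classical
  let F : ℕ → Finset P := fun k => Finset.univ.filter (fun u => u ∈ CausalPast σ p (r - k * M) r)
  have hmem : ∀ k u, u ∈ F k ↔ u ∈ CausalPast σ p (r - k * M) r := by simp [F]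
  have hmono : ∀ k, F k ⊆ F (k + 1) := fun k u hu => (hmem _ _).2
    (causalPast_mono hσ (Nat.sub_le_sub_left (Nat.mul_le_mul_right M (Nat.le_succ k)) r)
      (by omega) le_rfl ((hmem _ _).1 hu))
  have hself : ∀ k, p ∈ F k := fun k => (hmem _ _).2 (self_mem_causalPast hσ p (by omega))
  -- Sampling the past once per block of `M` rounds suffices: by monotonicity, equal endpoints force
  -- it to be constant in between.
  obtain ⟨k, hk, hkeq⟩ : ∃ k < N, F k = F (k + 1) := by
    by_contra! hne
    have hgrow : ∀ k ≤ N, k + 1 ≤ (F k).card := by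
      intro k
      induction k with
      | zero => exact fun _ => Finset.card_pos.2 ⟨p, hself 0⟩
      | succ k ih =>
        intro hk
        have := Finset.card_lt_card ((hmono k).ssubset_of_ne (hne k (by omega)))
        have := ih (by omega)
        omega
    have := hgrow N le_rfl
    have := Finset.card_le_univ (F N)
    omega
  have hkN : (k + 1) * M ≤ N * M := Nat.mul_le_mul_right M hk
  have hkM : (k + 1) * M = k * M + M := by ring
  have haM : r - (k + 1) * M + M = r - k * M := by omega
  have hknown : ∀ s, r - (k + 1) * M ≤ s → s ≤ r - (k + 1) * M + M → ∀ q ∈ F k,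
      q ∈ CausalPast σ p s r := fun s h1 h2 q hq =>
    causalPast_mono hσ (by omega) (by omega) le_rfl ((hmem _ _).1 hq)
  refine ⟨r - (k + 1) * M, F k, ⟨p, hself k⟩, by omega, by omega, fun s h1 h2 => ?_, hknown⟩
  obtain ⟨t, rfl⟩ : ∃ t, s = t + 1 := ⟨s - 1, by omega⟩
  refine isInClosed_of_causalPast (p := p) (c := r) (by omega)
    (hknown (t + 1) h1.le h2) (fun q hq => ?_)
  rw [hkeq]
  exact (hmem _ _).2 (causalPast_mono hσ (by omega) (by omega) le_rfl hq)

end CausalPast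

namespace ConsensusAlg

/-! ### Executions in terms of the known states -/

section Execution

variable {P : Type u} {V : Type v}

open Classical in
/-- What `p` knows in the computation of round `r`: the states of previous rounds in its causal
past. -/
noncomputable def view (σ : ℕ → Digraph P) (ρ : ℕ → P → Record P V) (r : ℕ) (p : P) :
    Knowledge P V :=
  fun s q => if s < r ∧ q ∈ CausalPast σ p s r then some (ρ s q) else none

theorem view_eq_some {σ : ℕ → Digraph P} {ρ : ℕ → P → Record P V} {r s : ℕ} {p q : P}
    {w : Record P V} :
    view σ ρ r p s q = some w ↔ (s < r ∧ q ∈ CausalPast σ p s r) ∧ ρ s q = w := by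
  unfold view
  split_ifs with h <;> simp [h]

theorem isSome_view {σ : ℕ → Digraph P} {ρ : ℕ → P → Record P V} {r s : ℕ} {p q : P} :
    (view σ ρ r p s q).isSome ↔ s < r ∧ q ∈ CausalPast σ p s r := by
  unfold view
  split_ifs with h <;> simp [h]

/-- `ρ s q` is the record of the round `s` state of `q` in the execution with inputs `x` under the
graph sequence `σ`. -/
structure IsExecution [Fintype P] [LinearOrder V] (D N : ℕ) (x : P → V) (σ : ℕ → Digraph P)
    (ρ : ℕ → P → Record P V) : Prop where
  init : ∀ p, (ρ 0 p).vars = ⟨x p, true, 1, ∅, none⟩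
  heard : ∀ s q u, 1 ≤ s → (u ∈ (ρ s q).heard ↔ (σ s).Adj u q)
  step : ∀ r p, (ρ (r + 1) p).vars = decideNow D N (view σ ρ (r + 1) p) (r + 1)
    (adopt N (view σ ρ (r + 1) p) (r + 1) (backoff N (view σ ρ (r + 1) p) (r + 1)
      (detect D (view σ ρ (r + 1) p) (r + 1) (ρ r p).vars)))

variable [Fintype P] [LinearOrder V]

/-- The execution of the consensus algorithm. -/
noncomputable def run (D N : ℕ) (x : P → V) (σ : ℕ → Digraph P) (r : ℕ) (p : P) :
    LocalState P V :=
  (consensusAlgorithm P V D N).config x σ r p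

open Classical in
/-- The records of the states in the execution of the consensus algorithm. -/
noncomputable def record (D N : ℕ) (x : P → V) (σ : ℕ → Digraph P) (s : ℕ) (q : P) :
    Record P V :=
  ⟨(run D N x σ s q).vars, if s = 0 then ∅ else Finset.univ.filter (fun u => (σ s).Adj u q)⟩

open Classical in
/-- The messages received in round `r + 1`. -/
noncomputable def inboxAt (D N : ℕ) (x : P → V) (σ : ℕ → Digraph P) (r : ℕ) (p : P) :
    P → Option (LocalState P V) :=
  fun q => if (σ (r + 1)).Adj q p then some (run D N x σ r q) else none

theorem run_succ (D N : ℕ) (x : P → V) (σ : ℕ → Digraph P) (r : ℕ) (p : P) :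
    run D N x σ (r + 1) p = nextState D N p (run D N x σ r p) (inboxAt D N x σ r p) := rfl

theorem round_run (D N : ℕ) (x : P → V) (σ : ℕ → Digraph P) (r : ℕ) (p : P) :
    (run D N x σ r p).round = r := by
  induction r with
  | zero => rfl
  | succ r ih => rw [run_succ]; simp [nextState, ih]

/-- The causal past grows by one round exactly by taking the union over the in-neighbours. The
hypothesis `hk` is the induction hypothesis of `know_run`. -/
theorem merge_eq_view {D N : ℕ} {x : P → V} {σ : ℕ → Digraph P} (hσ : σ ∈ Unrestricted P)
    {r : ℕ}
    (hk : ∀ p s q w, (run D N x σ r p).know s q = some w ↔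
      (s ≤ r ∧ q ∈ CausalPast σ p s r) ∧ record D N x σ s q = w) (p : P) :
    merge (run D N x σ r p) (inboxAt D N x σ r p) = view σ (record D N x σ) (r + 1) p := by
  funext s q
  have key : ∀ w, ((run D N x σ r p).know s q = some w ∨ ∃ u st', inboxAt D N x σ r p u = some st' ∧
      st'.know s q = some w) ↔ view σ (record D N x σ) (r + 1) p s q = some w := by
    intro w
    rw [view_eq_some, Nat.lt_succ_iff]
    constructor
    · rintro (h | ⟨u, st', h1, h2⟩)
      · obtain ⟨⟨h1, h2⟩, h3⟩ := (hk _ _ _ _).1 h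
        exact ⟨⟨h1, causalPast_mono hσ le_rfl h1 (by omega) h2⟩, h3⟩
      · unfold inboxAt at h1
        split_ifs at h1 with hadj
        obtain rfl := Option.some.inj h1
        obtain ⟨⟨h1, h2⟩, h3⟩ := (hk _ _ _ _).1 h2
        exact ⟨⟨h1, (mem_causalPast_succ h1).2 ⟨u, h2, hadj⟩⟩, h3⟩
    · rintro ⟨⟨h1, h2⟩, h3⟩
      obtain ⟨u, hu, hadj⟩ := (mem_causalPast_succ h1).1 h2
      exact .inr ⟨u, _, by simp [inboxAt, hadj], (hk _ _ _ _).2 ⟨⟨h1, hu⟩, h3⟩⟩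
  unfold merge
  split_ifs with h
  -- The choice in `merge` is harmless: all sources report the same record of a given state.
  · exact ((key _).1 h.choose_spec).symm
  · cases hv : view σ (record D N x σ) (r + 1) p s q with
    | none => rfl
    | some w => exact absurd ⟨w, (key w).2 hv⟩ h

theorem know_run {D N : ℕ} {x : P → V} {σ : ℕ → Digraph P} (hσ : σ ∈ Unrestricted P) (r : ℕ) :
    ∀ p s q w, (run D N x σ r p).know s q = some w ↔
      (s ≤ r ∧ q ∈ CausalPast σ p s r) ∧ record D N x σ s q = w := by
  classical
  induction r with
  | zero =>
    intro p s q w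
    have h0 : (run D N x σ 0 p).know s q =
        if s = 0 ∧ q = p then some ⟨(run D N x σ 0 p).vars, ∅⟩ else none := by
      by_cases h : s = 0 ∧ q = p <;> simp [run, Algorithm.config, consensusAlgorithm, initState, h]
    rw [h0, Nat.le_zero]
    by_cases hs : s = 0
    · subst hs
      rw [mem_causalPast_self]
      by_cases hq : q = p
      · subst hq; simp [record]
      · simp [hq]
    · simp [hs]
  | succ r ih =>
    intro p s q w
    have hm := merge_eq_view hσ ih p
    have h1 : (run D N x σ (r + 1) p).know s q =
        if s = r + 1 ∧ q = p then some (record D N x σ (r + 1) p)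
        else view σ (record D N x σ) (r + 1) p s q := by
      rw [← hm]
      by_cases h : s = r + 1 ∧ q = p
      · have : record D N x σ (r + 1) p = ⟨(run D N x σ (r + 1) p).vars,
            Finset.univ.filter (fun u => (inboxAt D N x σ r p u).isSome)⟩ := by
          unfold record
          congr 1
          ext u
          by_cases hu : (σ (r + 1)).Adj u p <;> simp [inboxAt, hu]
        rw [if_pos h, this, run_succ]
        simp [nextState, round_run, h]
      · rw [if_neg h, run_succ]
        simp [nextState, round_run, h]
    rw [h1]
    by_cases hs : s = r + 1
    · subst hs
      rw [mem_causalPast_self]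
      by_cases hq : q = p
      · subst hq; simp
      · rw [if_neg (by simp [hq]), view_eq_some]; simp [hq]
    · rw [if_neg (by simp [hs]), view_eq_some]
      have : s < r + 1 ↔ s ≤ r + 1 := by omega
      rw [this]

/-- This replaces message passing by causal pasts; the later arguments use only `IsExecution` and
`view`. -/
theorem isExecution_record {D N : ℕ} {x : P → V} {σ : ℕ → Digraph P} (hσ : σ ∈ Unrestricted P) :
    IsExecution D N x σ (record D N x σ) where
  init _ := rfl
  heard s q u hs := by simp [record, show s ≠ 0 by omega]
  step r p := by
    rw [← merge_eq_view hσ (know_run hσ r) p]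
    change (run D N x σ (r + 1) p).vars = _
    rw [run_succ]
    simp only [nextState, round_run]
    rfl

end Execution

end ConsensusAlg

namespace ConsensusAlg

/-! ### The blocks of the computation of a round -/

section Blocks

variable {P : Type u} {V : Type v}

theorem mem_knownStates_view {σ : ℕ → Digraph P} {ρ : ℕ → P → Record P V} {r a b s : ℕ} {p q : P}
    {z : Vars V} : (q, s, z) ∈ knownStates (view σ ρ r p) r a b ↔
      (r - a < r ∧ q ∈ CausalPast σ p (r - a) r) ∧ r - b ≤ s ∧
        (s < r ∧ q ∈ CausalPast σ p s r) ∧ (ρ s q).vars = z := by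
  simp only [knownStates, Set.mem_ofPred_eq, isSome_view, view_eq_some]
  constructor
  · rintro ⟨h1, h2, w, ⟨h3, rfl⟩, h4⟩
    exact ⟨h1, h2, h3, h4⟩
  · rintro ⟨h1, h2, h3, h4⟩
    exact ⟨h1, h2, _, ⟨h3, rfl⟩, h4⟩

theorem backoff_cases (N : ℕ) (K : Knowledge P V) (r : ℕ) (w : Vars V) :
    (¬ (w.lockRound + N ≤ r ∧ (evidence N K r w).Nonempty) ∧ backoff N K r w = w) ∨
    (w.lockRound + N ≤ r ∧ (evidence N K r w).Nonempty ∧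
      ∃ Q : Finset ℕ, (∀ t, t ∈ Q ↔ t ∈ w.queue ∧ ∀ s ∈ evidence N K r w, s < t) ∧
        ((∃ m ∈ Q, (∀ t ∈ Q, m ≤ t) ∧
          backoff N K r w = { w with queue := Q, lockRound := m }) ∨
        (Q = ∅ ∧ backoff N K r w = { w with queue := Q, locked := false }))) := by
  classical
  by_cases h : w.lockRound + N ≤ r ∧ (evidence N K r w).Nonempty
  · refine .inr ⟨h.1, h.2, w.queue.filter (fun t => ¬ ∃ s ∈ evidence N K r w, t ≤ s),
      by simp, ?_⟩
    by_cases hQ : (w.queue.filter (fun t => ¬ ∃ s ∈ evidence N K r w, t ≤ s)).Nonempty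
    · refine .inl ⟨_, Finset.min'_mem _ hQ, fun t ht => Finset.min'_le _ _ ht, ?_⟩
      unfold backoff
      rw [if_pos h]
      simp only []
      convert dif_pos hQ
    · refine .inr ⟨Finset.not_nonempty_iff_eq_empty.1 hQ, ?_⟩
      unfold backoff
      rw [if_pos h]
      simp only []
      convert dif_neg hQ
  · exact .inl ⟨h, if_neg h⟩

theorem adopt_cases (N : ℕ) (K : Knowledge P V) (r : ℕ) (w : Vars V) :
    (¬ (w.lockRound + 2 * N ≤ r ∧ ∃ y, lockedProposals N K r = {y} ∧ y ≠ w.proposal) ∧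
      adopt N K r w = w) ∨
    (w.lockRound + 2 * N ≤ r ∧ ∃ y, lockedProposals N K r = {y} ∧ y ≠ w.proposal ∧
      adopt N K r w = { w with proposal := y }) := by
  by_cases h : w.lockRound + 2 * N ≤ r ∧ ∃ y, lockedProposals N K r = {y} ∧ y ≠ w.proposal
  · exact .inr ⟨h.1, h.2.choose, h.2.choose_spec.1, h.2.choose_spec.2, dif_pos h⟩
  · exact .inl ⟨h, dif_neg h⟩

/-- The condition of the last block. -/
def CanDecide (D N : ℕ) (K : Knowledge P V) (r : ℕ) (w : Vars V) : Prop :=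
  w.decision = none ∧ w.lockRound + N * (D + 2 * N) ≤ r ∧
    ∀ q s z, (q, s, z) ∈ knownStates K r (N * (D + 2 * N)) ((D + 2 * N) ^ 2) →
      z.locked = true ∧ z.proposal = w.proposal

theorem decideNow_cases (D N : ℕ) (K : Knowledge P V) (r : ℕ) (w : Vars V) :
    (¬ CanDecide D N K r w ∧ decideNow D N K r w = w) ∨
    (CanDecide D N K r w ∧ decideNow D N K r w = { w with decision := some w.proposal }) := by
  by_cases h : CanDecide D N K r w
  · exact .inr ⟨h, if_pos h⟩
  · exact .inl ⟨h, if_neg h⟩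

theorem decision_backoff (N : ℕ) (K : Knowledge P V) (r : ℕ) (w : Vars V) :
    (backoff N K r w).decision = w.decision := by
  rcases backoff_cases N K r w with ⟨-, h⟩ | ⟨-, -, Q, -, ⟨m, -, -, h⟩ | ⟨-, h⟩⟩ <;> rw [h]

theorem proposal_backoff (N : ℕ) (K : Knowledge P V) (r : ℕ) (w : Vars V) :
    (backoff N K r w).proposal = w.proposal := by
  rcases backoff_cases N K r w with ⟨-, h⟩ | ⟨-, -, Q, -, ⟨m, -, -, h⟩ | ⟨-, h⟩⟩ <;> rw [h]

theorem decision_adopt (N : ℕ) (K : Knowledge P V) (r : ℕ) (w : Vars V) :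
    (adopt N K r w).decision = w.decision := by
  rcases adopt_cases N K r w with ⟨-, h⟩ | ⟨-, y, -, -, h⟩ <;> rw [h]

theorem locked_adopt (N : ℕ) (K : Knowledge P V) (r : ℕ) (w : Vars V) :
    (adopt N K r w).locked = w.locked := by
  rcases adopt_cases N K r w with ⟨-, h⟩ | ⟨-, y, -, -, h⟩ <;> rw [h]

theorem lockRound_adopt (N : ℕ) (K : Knowledge P V) (r : ℕ) (w : Vars V) :
    (adopt N K r w).lockRound = w.lockRound := by
  rcases adopt_cases N K r w with ⟨-, h⟩ | ⟨-, y, -, -, h⟩ <;> rw [h]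

theorem proposal_decideNow (D N : ℕ) (K : Knowledge P V) (r : ℕ) (w : Vars V) :
    (decideNow D N K r w).proposal = w.proposal := by
  rcases decideNow_cases D N K r w with ⟨-, h⟩ | ⟨-, h⟩ <;> rw [h]

theorem locked_decideNow (D N : ℕ) (K : Knowledge P V) (r : ℕ) (w : Vars V) :
    (decideNow D N K r w).locked = w.locked := by
  rcases decideNow_cases D N K r w with ⟨-, h⟩ | ⟨-, h⟩ <;> rw [h]

theorem lockRound_decideNow (D N : ℕ) (K : Knowledge P V) (r : ℕ) (w : Vars V) :
    (decideNow D N K r w).lockRound = w.lockRound := by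
  rcases decideNow_cases D N K r w with ⟨-, h⟩ | ⟨-, h⟩ <;> rw [h]

theorem queue_decideNow (D N : ℕ) (K : Knowledge P V) (r : ℕ) (w : Vars V) :
    (decideNow D N K r w).queue = w.queue := by
  rcases decideNow_cases D N K r w with ⟨-, h⟩ | ⟨-, h⟩ <;> rw [h]

end Blocks

/-! ### Root estimates -/

section RootValues

variable {P : Type u} {V : Type v} [LinearOrder V]
  {σ : ℕ → Digraph P} {ρ : ℕ → P → Record P V}

/-- `y` is the largest proposal of the members of the root component of round `s`. -/
def IsRootValue (σ : ℕ → Digraph P) (ρ : ℕ → P → Record P V) (s : ℕ) (y : V) : Prop :=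
  1 ≤ s ∧ ∃ (R : Finset P) (hR : R.Nonempty), HasRoot (σ s) R ∧
    y = R.sup' hR (fun q => (ρ s q).vars.proposal)

/-- The root value is a proposal of a member of the root component. -/
theorem IsRootValue.exists_mem {s : ℕ} {y : V} (h : IsRootValue σ ρ s y) :
    ∃ R, HasRoot (σ s) R ∧ ∃ q ∈ R, y = (ρ s q).vars.proposal := by
  obtain ⟨-, R, hne, hR, rfl⟩ := h
  obtain ⟨q, hq, he⟩ := Finset.exists_mem_eq_sup' hne (fun q => (ρ s q).vars.proposal)
  exact ⟨R, hR, q, hq, he⟩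

theorem IsRootValue.unique {s : ℕ} {y z : V} (h : IsRootValue σ ρ s y)
    (h' : IsRootValue σ ρ s z) : y = z := by
  obtain ⟨-, R, hne, hR, rfl⟩ := h
  obtain ⟨-, R', hne', hR', rfl⟩ := h'
  obtain rfl := hR.unique hR'
  rfl

theorem detect_of_none {D : ℕ} {r : ℕ} {p : P} {w : Vars V}
    (hnone : rootEst (view σ ρ r p) (r - D) = none) : detect D (view σ ρ r p) r w = w := by
  unfold detect
  simp [hnone]

end RootValues

section RootEstimates

variable {P : Type u} {V : Type v} [Fintype P] [LinearOrder V]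
  {D N : ℕ} {x : P → V} {σ : ℕ → Digraph P} {ρ : ℕ → P → Record P V}

/-- Once the in-neighbourhoods of all members of `R` are known, the known graph and the true graph
have the same edges into `R`, and `IsRootComponent.congr` applies. -/
theorem IsExecution.isCertainRoot_iff (h : IsExecution D N x σ ρ) {r s : ℕ} {p : P}
    {R : Finset P} : IsCertainRoot (view σ ρ r p) s R ↔
      1 ≤ s ∧ (∀ q ∈ R, s < r ∧ q ∈ CausalPast σ p s r) ∧ IsRootComponent (σ s) R := by
  unfold IsCertainRoot
  simp only [isSome_view]
  refine and_congr_right fun hs => and_congr_right fun hR => ?_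
  have key : ∀ q ∈ R, ∀ u, (approxGraph (view σ ρ r p) s).Adj u q ↔ (σ s).Adj u q := by
    intro q hq u
    simp only [approxGraph, view_eq_some]
    constructor
    · rintro ⟨w, ⟨-, rfl⟩, hu⟩
      exact (h.heard s q u hs).1 hu
    · exact fun hu => ⟨_, ⟨hR q hq, rfl⟩, (h.heard s q u hs).2 hu⟩
  exact ⟨fun hc => hc.congr key, fun hc => hc.congr (fun q hq u => (key q hq u).symm)⟩

theorem IsExecution.of_rootEst_eq_some (h : IsExecution D N x σ ρ) (hσ : σ ∈ ROOTED P) {r s : ℕ}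
    {p : P} {R : Finset P} (hR : rootEst (view σ ρ r p) s = some R) :
    1 ≤ s ∧ s < r ∧ HasRoot (σ s) R ∧ ∀ q ∈ R, q ∈ CausalPast σ p s r := by
  unfold rootEst at hR
  split_ifs at hR with hex
  obtain rfl := Option.some.inj hR
  obtain ⟨h1, h2, h3⟩ := h.isCertainRoot_iff.1 hex.choose_spec
  obtain ⟨R', hR'⟩ := hσ.2 s h1
  obtain ⟨q, hq⟩ := h3.1
  exact ⟨h1, (h2 q hq).1, hR'.2 _ h3 ▸ hR', fun q hq => (h2 q hq).2⟩

theorem IsExecution.rootEst_eq_some (h : IsExecution D N x σ ρ) (hσ : σ ∈ ROOTED P) {r s : ℕ}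
    {p : P} {R : Finset P} (hs : 1 ≤ s) (hsr : s < r) (hR : HasRoot (σ s) R)
    (hknown : ∀ q ∈ R, q ∈ CausalPast σ p s r) : rootEst (view σ ρ r p) s = some R := by
  have hex : ∃ R, IsCertainRoot (view σ ρ r p) s R :=
    ⟨R, h.isCertainRoot_iff.2 ⟨hs, fun q hq => ⟨hsr, hknown q hq⟩, hR.1⟩⟩
  have h1 : rootEst (view σ ρ r p) s = some hex.choose := dif_pos hex
  rw [h1, (h.of_rootEst_eq_some hσ h1).2.2.1.unique hR]

theorem IsExecution.detect_of_rootEst (h : IsExecution D N x σ ρ) (hσ : σ ∈ ROOTED P) {r : ℕ}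
    {p : P} {w : Vars V} {R : Finset P} (hR : rootEst (view σ ρ r p) (r - D) = some R) :
    ∃ y, IsRootValue σ ρ (r - D) y ∧
      ((w.locked = false ∨ (y ≠ w.proposal ∧ 1 < (rootsSinceLock D (view σ ρ r p) r w).card)) ∧
        detect D (view σ ρ r p) r w = { w with proposal := y, locked := true, lockRound := r } ∨
      ¬ (w.locked = false ∨
          (y ≠ w.proposal ∧ 1 < (rootsSinceLock D (view σ ρ r p) r w).card)) ∧
        (y = w.proposal ∧ detect D (view σ ρ r p) r w = { w with queue := insert r w.queue } ∨
          y ≠ w.proposal ∧ detect D (view σ ρ r p) r w = w)) := by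
  classical
  obtain ⟨h1, h2, h3, h4⟩ := h.of_rootEst_eq_some hσ hR
  have hne : R.Nonempty := h3.1.1
  -- All members of `R` are known, so the default in `proposalOf` never enters the maximum.
  have hval : R.sup' hne (proposalOf (view σ ρ r p) (r - D) w.proposal) =
      R.sup' hne (fun q => (ρ (r - D) q).vars.proposal) := by
    refine Finset.sup'_congr hne rfl fun q hq => ?_
    simp [proposalOf, view_eq_some.2 ⟨⟨h2, h4 q hq⟩, rfl⟩]
  have hd : detect D (view σ ρ r p) r w =
      if w.locked = false ∨ (R.sup' hne (fun q => (ρ (r - D) q).vars.proposal) ≠ w.proposal ∧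
          1 < (rootsSinceLock D (view σ ρ r p) r w).card) then
        { w with proposal := R.sup' hne (fun q => (ρ (r - D) q).vars.proposal), locked := true,
                 lockRound := r }
      else if R.sup' hne (fun q => (ρ (r - D) q).vars.proposal) = w.proposal then
        { w with queue := insert r w.queue }
      else w := by
    unfold detect
    rw [hR]
    simp only [hne, dif_pos, hval]
  refine ⟨_, ⟨h1, R, hne, h3, rfl⟩, ?_⟩
  split_ifs at hd with c1 c2
  · exact .inl ⟨c1, hd⟩
  · exact .inr ⟨c1, .inl ⟨c2, by rw [hd]⟩⟩
  · exact .inr ⟨c1, .inr ⟨c2, hd⟩⟩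

/-- A weaker case list that forgets the condition on `T`. It suffices for invariants and agreement;
only termination needs the exact condition. -/
theorem IsExecution.detect_cases (h : IsExecution D N x σ ρ) (hσ : σ ∈ ROOTED P) (r : ℕ)
    (p : P) (w : Vars V) :
    detect D (view σ ρ r p) r w = w ∨ ∃ y, D < r ∧ IsRootValue σ ρ (r - D) y ∧
      (detect D (view σ ρ r p) r w = { w with proposal := y, locked := true, lockRound := r } ∨
      (y = w.proposal ∧ w.locked = true ∧
        detect D (view σ ρ r p) r w = { w with queue := insert r w.queue })) := by
  cases hR : rootEst (view σ ρ r p) (r - D) with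
  | none => exact .inl (detect_of_none hR)
  | some R =>
    obtain ⟨y, hy, ⟨-, hd⟩ | ⟨hc, ⟨hy', hd⟩ | ⟨-, hd⟩⟩⟩ := h.detect_of_rootEst hσ (w := w) hR
    · exact .inr ⟨y, by have := hy.1; omega, hy, .inl hd⟩
    · refine .inr ⟨y, by have := hy.1; omega, hy, .inr ⟨hy', ?_, hd⟩⟩
      simpa using (not_or.1 hc).1
    · exact .inl hd

theorem IsExecution.decision_detect (h : IsExecution D N x σ ρ) (hσ : σ ∈ ROOTED P) (r : ℕ)
    (p : P) (w : Vars V) : (detect D (view σ ρ r p) r w).decision = w.decision := by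
  rcases h.detect_cases hσ r p w with hd | ⟨y, -, -, hd | ⟨-, -, hd⟩⟩ <;> rw [hd]

end RootEstimates

end ConsensusAlg

namespace ConsensusAlg

/-! ### Invariants of the variables -/

section Invariants

variable {P : Type u} {V : Type v}

/-- The relation between the variables of a process at the end of round `r` and the proposals of
the root components: the lock-round and the later rounds in the queue are rounds in which the
present proposal has been confirmed by a root component. -/
structure IsConsistent [LinearOrder V] (D N : ℕ) (σ : ℕ → Digraph P) (ρ : ℕ → P → Record P V)
    (r : ℕ) (w : Vars V) : Prop where
  queue_le : ∀ t ∈ w.queue, t ≤ r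
  lock_pos : 1 ≤ w.lockRound
  lock_le : w.lockRound ≤ max r 1
  queue_eq_empty : w.locked = false → w.queue = ∅
  lock_value : w.locked = true ∨ r < w.lockRound + 2 * N → D < w.lockRound →
    IsRootValue σ ρ (w.lockRound - D) w.proposal
  queue_value : ∀ t ∈ w.queue, w.lockRound ≤ t → D < t ∧ IsRootValue σ ρ (t - D) w.proposal

variable {D N : ℕ} {x : P → V} {σ : ℕ → Digraph P} {ρ : ℕ → P → Record P V}

theorem le_of_mem_evidence {r s : ℕ} {p : P} {w : Vars V}
    (hs : s ∈ evidence N (view σ ρ r p) r w) : r - N ≤ s ∧ s < r := by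
  obtain ⟨q, z, h, -⟩ := hs
  obtain ⟨-, h2, ⟨h3, -⟩, -⟩ := mem_knownStates_view.1 h
  exact ⟨h2, h3⟩

/-- The queue may hold stale rounds from before the last lock. A back-off discards them: it requires
`w.lockRound + N ≤ r`, so evidence, being at most `N` rounds old, is no older than the lock round,
and only queue entries after all evidence survive. -/
theorem IsConsistent.backoff [LinearOrder V] {r : ℕ} {p : P} {w : Vars V}
    (h : IsConsistent D N σ ρ r w) :
    IsConsistent D N σ ρ r (backoff N (view σ ρ r p) r w) := by
  rcases backoff_cases N (view σ ρ r p) r w with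
    ⟨-, hb⟩ | ⟨hr, ⟨s, hs⟩, Q, hQ, ⟨m, hm, hmin, hb⟩ | ⟨rfl, hb⟩⟩
  · rwa [hb]
  · have hsle := le_of_mem_evidence hs
    have hlt : ∀ t ∈ Q, w.lockRound ≤ t := fun t ht => by
      have := ((hQ t).1 ht).2 s hs
      omega
    have hmv := h.queue_value m ((hQ m).1 hm).1 (hlt m hm)
    have hmr := h.queue_le m ((hQ m).1 hm).1
    rw [hb]
    exact
    { queue_le := fun t ht => h.queue_le t ((hQ t).1 ht).1
      lock_pos := show 1 ≤ m by omega
      lock_le := show m ≤ max r 1 by omega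
      queue_eq_empty := fun hl => by
        rw [h.queue_eq_empty hl] at hQ
        exact absurd ((hQ m).1 hm).1 (by simp)
      lock_value := fun _ _ => hmv.2
      queue_value := fun t ht _ => h.queue_value t ((hQ t).1 ht).1 (hlt t ht) }
  · rw [hb]
    exact
    { queue_le := by simp
      lock_pos := h.lock_pos
      lock_le := h.lock_le
      queue_eq_empty := fun _ => rfl
      lock_value := fun hl => h.lock_value (.inr (hl.resolve_left (by simp)))
      queue_value := by simp }

theorem IsConsistent.decideNow [LinearOrder V] {r : ℕ} {K : Knowledge P V} {w : Vars V}
    (h : IsConsistent D N σ ρ r w) : IsConsistent D N σ ρ r (decideNow D N K r w) := by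
  rcases decideNow_cases D N K r w with ⟨-, hd⟩ | ⟨-, hd⟩
  · rwa [hd]
  · rw [hd]
    exact { h with }

variable [Fintype P] [LinearOrder V]

theorem IsConsistent.detect (hex : IsExecution D N x σ ρ) (hσ : σ ∈ ROOTED P) {r : ℕ} {p : P}
    {w : Vars V} (h : IsConsistent D N σ ρ r w) :
    IsConsistent D N σ ρ (r + 1) (detect D (view σ ρ (r + 1) p) (r + 1) w) := by
  have hql := h.queue_le
  have hll := h.lock_le
  rcases hex.detect_cases hσ (r + 1) p w with hd | ⟨y, hDr, hy, hd | ⟨rfl, hl, hd⟩⟩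
  · rw [hd]
    exact { h with
      queue_le := fun t ht => (hql t ht).trans (by omega)
      lock_le := hll.trans (by omega)
      lock_value := fun hl => h.lock_value (hl.imp_right (by omega)) }
  · rw [hd]
    exact
    { queue_le := fun t ht => (hql t ht).trans (by omega)
      lock_pos := show 1 ≤ r + 1 by omega
      lock_le := show r + 1 ≤ max (r + 1) 1 by omega
      queue_eq_empty := by simp
      lock_value := fun _ _ => hy
      queue_value := fun t ht hlt => by
        have := hql t ht
        exact absurd (show r + 1 ≤ t from hlt) (by omega) }
  · rw [hd]
    refine { h with
      queue_le := fun t ht => ?_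
      lock_le := hll.trans (by omega)
      queue_eq_empty := fun hl' => absurd (hl.symm.trans hl') (by simp)
      lock_value := fun hl => h.lock_value (hl.imp_right (by simp only; omega))
      queue_value := fun t ht hlt => ?_ }
    · rcases Finset.mem_insert.1 ht with rfl | ht
      · exact le_rfl
      · exact (hql t ht).trans (by omega)
    · rcases Finset.mem_insert.1 ht with rfl | ht
      · exact ⟨hDr, hy⟩
      · exact h.queue_value t ht hlt

/-- A process that is locked after the second block does not adopt a proposal, because its own
previous state is known to itself. -/
theorem IsExecution.adopt_of_locked (hex : IsExecution D N x σ ρ) (hσ : σ ∈ ROOTED P)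
    (hN : 1 ≤ N) {r : ℕ} {p : P}
    (hl : (backoff N (view σ ρ (r + 1) p) (r + 1)
      (detect D (view σ ρ (r + 1) p) (r + 1) (ρ r p).vars)).locked = true) :
    adopt N (view σ ρ (r + 1) p) (r + 1) (backoff N (view σ ρ (r + 1) p) (r + 1)
      (detect D (view σ ρ (r + 1) p) (r + 1) (ρ r p).vars)) =
    backoff N (view σ ρ (r + 1) p) (r + 1)
      (detect D (view σ ρ (r + 1) p) (r + 1) (ρ r p).vars) := by
  set w₁ := detect D (view σ ρ (r + 1) p) (r + 1) (ρ r p).vars with hw₁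
  set w₂ := backoff N (view σ ρ (r + 1) p) (r + 1) w₁ with hw₂
  rcases adopt_cases N (view σ ρ (r + 1) p) (r + 1) w₂ with ⟨-, ha⟩ | ⟨hr, y, hy, hne, -⟩
  · exact ha
  exfalso
  -- With `1 ≤ N` the bound excludes a lock set by `detect` in this very round, so the previous
  -- state already had the same proposal and was locked.
  have hlock : w₁.locked = true ∧ w₁.lockRound + N ≤ r + 1 := by
    rcases backoff_cases N (view σ ρ (r + 1) p) (r + 1) w₁ with
      ⟨-, hb⟩ | ⟨hr', -, Q, -, ⟨m, -, -, hb⟩ | ⟨-, hb⟩⟩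
    · rw [← hw₂] at hb
      rw [← hb]
      exact ⟨hl, by omega⟩
    · rw [hw₂, hb] at hl
      exact ⟨hl, hr'⟩
    · rw [hw₂, hb] at hl
      simp at hl
  have hold : (ρ r p).vars.locked = true ∧ (ρ r p).vars.proposal = w₁.proposal := by
    rcases hex.detect_cases hσ (r + 1) p (ρ r p).vars with hd | ⟨y, -, -, hd | ⟨-, -, hd⟩⟩
    · rw [hw₁, hd] at hlock ⊢
      exact ⟨hlock.1, rfl⟩
    · rw [hw₁, hd] at hlock
      have : r + 1 + N ≤ r + 1 := hlock.2
      omega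
    · rw [hw₁, hd] at hlock ⊢
      exact ⟨hlock.1, rfl⟩
  have hmem : (ρ r p).vars.proposal ∈ lockedProposals N (view σ ρ (r + 1) p) (r + 1) :=
    ⟨p, r, _, mem_knownStates_view.2 ⟨⟨by omega, self_mem_causalPast hσ.1 p (by omega)⟩, by omega,
      ⟨by omega, self_mem_causalPast hσ.1 p (by omega)⟩, rfl⟩, hold.1, rfl⟩
  rw [hy, Set.mem_singleton_iff, hold.2, ← proposal_backoff N (view σ ρ (r + 1) p) (r + 1)] at hmem
  exact hne hmem.symm

/-- Only the third block could break the link between proposal and lock round. It acts only on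
unlocked processes at least `2 * N` rounds after the lock round, where `lock_value` claims nothing
and the queue is empty. The initial lock round `1` is exempt because `1 ≤ D`. -/
theorem IsExecution.isConsistent (hex : IsExecution D N x σ ρ) (hσ : σ ∈ ROOTED P)
    (hD : 1 ≤ D) (hN : 1 ≤ N) (r : ℕ) (p : P) : IsConsistent D N σ ρ r (ρ r p).vars := by
  induction r with
  | zero =>
    rw [hex.init]
    exact ⟨by simp, le_rfl, by simp, by simp, fun _ h => absurd (show D < 1 from h) (by omega),
      by simp⟩
  | succ r ih =>
    have h₂ := (ih.detect hex hσ (p := p)).backoff (p := p)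
    rw [hex.step]
    refine IsConsistent.decideNow ?_
    have hadopt := hex.adopt_of_locked hσ hN (r := r) (p := p)
    generalize ConsensusAlg.backoff N (view σ ρ (r + 1) p) (r + 1)
      (ConsensusAlg.detect D (view σ ρ (r + 1) p) (r + 1) (ρ r p).vars) = w at h₂ hadopt ⊢
    rcases adopt_cases N (view σ ρ (r + 1) p) (r + 1) w with ⟨-, ha⟩ | ⟨hr, y, -, -, ha⟩
    · rwa [ha]
    · cases hw : w.locked with
      | true => rwa [hadopt hw]
      | false =>
        have hQ := h₂.queue_eq_empty hw
        rw [ha]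
        exact
        { queue_le := h₂.queue_le
          lock_pos := h₂.lock_pos
          lock_le := h₂.lock_le
          queue_eq_empty := h₂.queue_eq_empty
          lock_value := fun hl => by simp only at hl; rw [hw] at hl; simp at hl; omega
          queue_value := by simp [hQ] }

/-- Only the last block writes the decision, and it leaves proposal and lock round alone, so its
guard can be read off the new state. -/
theorem IsExecution.decision_succ (hex : IsExecution D N x σ ρ) (hσ : σ ∈ ROOTED P) (r : ℕ)
    (p : P) : (ρ (r + 1) p).vars.decision = (ρ r p).vars.decision ∨
      (ρ r p).vars.decision = none ∧
      (ρ (r + 1) p).vars.decision = some (ρ (r + 1) p).vars.proposal ∧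
      (ρ (r + 1) p).vars.lockRound + N * (D + 2 * N) ≤ r + 1 ∧
      ∀ q s, q ∈ CausalPast σ p (r + 1 - N * (D + 2 * N)) (r + 1) →
        r + 1 - N * (D + 2 * N) < r + 1 → r + 1 - (D + 2 * N) ^ 2 ≤ s → s < r + 1 →
        q ∈ CausalPast σ p s (r + 1) →
        (ρ s q).vars.locked = true ∧ (ρ s q).vars.proposal = (ρ (r + 1) p).vars.proposal := by
  have hdec : ∀ w, (adopt N (view σ ρ (r + 1) p) (r + 1) (backoff N (view σ ρ (r + 1) p) (r + 1)
      (detect D (view σ ρ (r + 1) p) (r + 1) w))).decision = w.decision := fun w => by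
    rw [decision_adopt, decision_backoff, hex.decision_detect hσ]
  rw [hex.step, proposal_decideNow, lockRound_decideNow, ← hdec (ρ r p).vars]
  generalize adopt N (view σ ρ (r + 1) p) (r + 1) (backoff N (view σ ρ (r + 1) p) (r + 1)
      (detect D (view σ ρ (r + 1) p) (r + 1) (ρ r p).vars)) = w
  rcases decideNow_cases D N (view σ ρ (r + 1) p) (r + 1) w with ⟨-, hd⟩ | ⟨hc, hd⟩
  · exact .inl (by rw [hd])
  · refine .inr ⟨hc.1, by rw [hd], hc.2.1, fun q s h1 h2 h3 h4 h5 => ?_⟩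
    exact hc.2.2 q s _ (mem_knownStates_view.2 ⟨⟨h2, h1⟩, h3, ⟨h4, h5⟩, rfl⟩)

/-- Every proposal is an input. -/
theorem IsExecution.exists_input (hex : IsExecution D N x σ ρ) (hσ : σ ∈ ROOTED P)
    (hD : 1 ≤ D) (r : ℕ) :
    ∀ p, ∃ q, x q = (ρ r p).vars.proposal := by
  induction r using Nat.strong_induction_on with
  | _ r ih =>
    rcases r with _ | r
    · exact fun p => ⟨p, by rw [hex.init]⟩
    intro p
    rw [hex.step, proposal_decideNow]
    rcases adopt_cases N (view σ ρ (r + 1) p) (r + 1) (backoff N (view σ ρ (r + 1) p) (r + 1)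
      (detect D (view σ ρ (r + 1) p) (r + 1) (ρ r p).vars)) with ⟨-, ha⟩ | ⟨-, y, hy, -, ha⟩
    · rw [ha, proposal_backoff]
      rcases hex.detect_cases hσ (r + 1) p (ρ r p).vars with hd | ⟨y, -, hy, hd | ⟨-, -, hd⟩⟩
      · rw [hd]; exact ih r (by omega) p
      · rw [hd]
        obtain ⟨R, hR, q, hq, rfl⟩ := hy.exists_mem
        exact ih _ (by omega) q
      · rw [hd]; exact ih r (by omega) p
    · rw [ha]
      obtain ⟨q, s, z, hz, -, hzy⟩ : y ∈ lockedProposals N (view σ ρ (r + 1) p) (r + 1) := by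
        rw [hy]; rfl
      obtain ⟨-, -, ⟨hs, -⟩, rfl⟩ := mem_knownStates_view.1 hz
      exact hzy ▸ ih s hs q

end Invariants

end ConsensusAlg

namespace ConsensusAlg

/-! ### Termination -/

section Termination

variable {P : Type u} {V : Type v}

/-- A stable period, extended as far as possible to earlier rounds. -/
theorem exists_stable_period {σ : ℕ → Digraph P} {D : ℕ} (hσ : σ ∈ STABILITY P (D + 1)) :
    ∃ (R : Finset P) (a : ℕ), (∀ r, a + 1 ≤ r → r ≤ a + D + 1 → HasRoot (σ r) R) ∧
      (a = 0 ∨ ¬ HasRoot (σ a) R) := by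
  classical
  obtain ⟨-, R, a, b, ha, hab, hle, hR⟩ := hσ
  -- Taking the least first round `m` makes round `m - 1`, if it is a round at all, lack the root
  -- `R`; this later yields two distinct root estimates.
  have hex : ∃ m, 1 ≤ m ∧ ∀ r, m ≤ r → r ≤ b → HasRoot (σ r) R := ⟨a, ha, hR⟩
  have hfind := Nat.find_spec hex
  have hmin := Nat.find_min' hex ⟨ha, hR⟩
  have hlt := fun k => Nat.find_min hex (m := k)
  generalize Nat.find hex = m at hfind hmin hlt
  refine ⟨R, m - 1, fun r h1 h2 => hfind.2 r (by omega) (by omega), ?_⟩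
  by_contra! hcon
  refine hlt (m - 1) (by omega) ⟨by omega, fun r h1 h2 => ?_⟩
  rcases h1.eq_or_lt with rfl | h1
  · exact hcon.2
  · exact hfind.2 r (by omega) h2

/-- The process is locked on `y` since round `r₀` at the latest, and the proposal `y` has been
confirmed in round `r₀`. -/
structure IsSettled (r₀ : ℕ) (y : V) (w : Vars V) : Prop where
  proposal_eq : w.proposal = y
  locked_eq : w.locked = true
  lock_le : w.lockRound ≤ r₀
  confirmed : w.lockRound = r₀ ∨ r₀ ∈ w.queue

variable {D N : ℕ} {x : P → V} {σ : ℕ → Digraph P} {ρ : ℕ → P → Record P V} {r₀ : ℕ} {y : V}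

theorem IsSettled.le_max {w : Vars V} (h : IsSettled r₀ y w) :
    r₀ ≤ max (w.queue.sup id) w.lockRound := by
  rcases h.confirmed with h | h
  · exact h ▸ le_max_right _ _
  · exact le_max_of_le_left (Finset.le_sup (f := id) h)

/-- Evidence can only stem from rounds before `r₀`. If a back-off happens, the lock round is at most
such a round, so `r₀` must be in the queue; it survives and bounds the new lock round. -/
theorem IsSettled.backoff {r : ℕ} {p : P} {w : Vars V} (h : IsSettled r₀ y w)
    (hprev : ∀ s q, r₀ ≤ s → s < r → (ρ s q).vars.locked = true ∧ (ρ s q).vars.proposal = y) :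
    IsSettled r₀ y (backoff N (view σ ρ r p) r w) := by
  have hev : ∀ s ∈ evidence N (view σ ρ r p) r w, s < r₀ := by
    rintro s ⟨q, z, hz, hc⟩
    obtain ⟨-, -, ⟨hs, -⟩, rfl⟩ := mem_knownStates_view.1 hz
    by_contra hlt
    obtain ⟨h1, h2⟩ := hprev s q (by omega) hs
    rw [h1, h2, h.proposal_eq] at hc
    simp at hc
  have hlock := h.lock_le
  rcases backoff_cases N (view σ ρ r p) r w with ⟨-, hb⟩ | ⟨hr, ⟨s, hs⟩, Q, hQ, hb⟩
  · rwa [hb]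
  · have h1 := hev s hs
    have h2 := le_of_mem_evidence hs
    have hmem : r₀ ∈ Q :=
      (hQ r₀).2 ⟨h.confirmed.resolve_left (by omega), hev⟩
    rcases hb with ⟨m, hm, hmin, hb⟩ | ⟨rfl, hb⟩
    · rw [hb]
      exact ⟨h.proposal_eq, h.locked_eq, hmin _ hmem, .inr hmem⟩
    · exact absurd hmem (by simp)

variable [Fintype P] [LinearOrder V]

theorem IsSettled.rest_of_round (hex : IsExecution D N x σ ρ) (hσ : σ ∈ ROOTED P) (hN : 1 ≤ N)
    {r : ℕ} {p : P}
    (h : IsSettled r₀ y (ConsensusAlg.detect D (view σ ρ (r + 1) p) (r + 1) (ρ r p).vars))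
    (hprev : ∀ s q, r₀ ≤ s → s < r + 1 →
      (ρ s q).vars.locked = true ∧ (ρ s q).vars.proposal = y) :
    IsSettled r₀ y (ρ (r + 1) p).vars := by
  have hb := h.backoff (N := N) (σ := σ) (p := p) hprev
  rw [hex.step, hex.adopt_of_locked hσ hN hb.locked_eq]
  exact ⟨by rw [proposal_decideNow]; exact hb.proposal_eq,
    by rw [locked_decideNow]; exact hb.locked_eq,
    by rw [lockRound_decideNow]; exact hb.lock_le,
    by rw [lockRound_decideNow, queue_decideNow]; exact hb.confirmed⟩

/-- In the last round of the stable period, every process confirms the root value. -/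
theorem IsExecution.isSettled_detect (hex : IsExecution D N x σ ρ) (hσ : σ ∈ ROOTED P)
    (hD : 1 ≤ D) (hN : 1 ≤ N) {R : Finset P} {a : ℕ} (hR : HasRoot (σ (a + 1)) R)
    (ha : a = 0 ∨ ¬ HasRoot (σ a) R) (hy : IsRootValue σ ρ (a + 1) y) (p : P)
    (hknown : ∀ q ∈ R, q ∈ CausalPast σ p (a + 1) (a + D + 1)) :
    IsSettled (a + D + 1) y
      (detect D (view σ ρ (a + D + 1) p) (a + D + 1) (ρ (a + D) p).vars) := by
  classical
  have hsub : a + D + 1 - D = a + 1 := by omega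
  have hest : rootEst (view σ ρ (a + D + 1) p) (a + D + 1 - D) = some R := by
    rw [hsub]
    exact hex.rootEst_eq_some hσ (by omega) (by omega) hR hknown
  have hcons := hex.isConsistent hσ hD hN (a + D) p
  have hlock := hcons.lock_le
  have hqueue : (ρ (a + D) p).vars.queue.sup id ≤ a + D := Finset.sup_le hcons.queue_le
  obtain ⟨z, hz, hd⟩ := hex.detect_of_rootEst hσ (w := (ρ (a + D) p).vars) hest
  rw [hsub] at hz
  obtain rfl := hz.unique hy
  rcases hd with ⟨-, hd⟩ | ⟨hc, ⟨hzp, hd⟩ | ⟨hne, -⟩⟩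
  · rw [hd]
    exact ⟨rfl, rfl, le_rfl, .inl rfl⟩
  · rw [hd]
    exact ⟨hzp.symm, by simpa using (not_or.1 hc).1,
      show (ρ (a + D) p).vars.lockRound ≤ _ by omega, .inr (Finset.mem_insert_self _ _)⟩
  -- Queue and lock round are at most `a + D`, so `T` reaches back to round `a`, whose estimate
  -- differs from `R`.
  · refine absurd (.inr ⟨hne, Finset.one_lt_card.2
      ⟨rootEst (view σ ρ (a + D + 1) p) (a + 1), ?_, rootEst (view σ ρ (a + D + 1) p) a, ?_, ?_⟩⟩)
      hc
    · exact Finset.mem_image_of_mem _ (Finset.mem_filter.2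
        ⟨Finset.mem_range.2 (by omega), by omega, by omega⟩)
    · exact Finset.mem_image_of_mem _ (Finset.mem_filter.2
        ⟨Finset.mem_range.2 (by omega), by omega, by omega⟩)
    · rw [← hsub, hest]
      intro heq
      obtain ⟨h1, -, h2, -⟩ := hex.of_rootEst_eq_some hσ heq.symm
      exact ha.elim (by omega) (fun h => h h2)

/-- Settled processes do not lock on another value, neither because of the rest of the stable
period, nor later on. -/
theorem IsSettled.detect (hex : IsExecution D N x σ ρ) (hσ : σ ∈ ROOTED P) (hD : 1 ≤ D)
    {R : Finset P} {a r : ℕ} (hR : ∀ s, a + 1 ≤ s → s ≤ a + D + 1 → HasRoot (σ s) R)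
    (hr : a + D + 1 ≤ r) {p : P} {w : Vars V} (h : IsSettled (a + D + 1) y w)
    (hprev : ∀ s q, a + D + 1 ≤ s → s < r + 1 → (ρ s q).vars.proposal = y) :
    IsSettled (a + D + 1) y
      (ConsensusAlg.detect D (view σ ρ (r + 1) p) (r + 1) w) := by
  classical
  cases hest : rootEst (view σ ρ (r + 1) p) (r + 1 - D) with
  | none => rwa [detect_of_none hest]
  | some R' =>
    obtain ⟨z, hz, hd⟩ := hex.detect_of_rootEst hσ (w := w) hest
    have hc : ¬ (w.locked = false ∨ (z ≠ w.proposal ∧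
        1 < (rootsSinceLock D (view σ ρ (r + 1) p) (r + 1) w).card)) := by
      rintro (hl | ⟨hne, hcard⟩)
      · exact absurd (h.locked_eq.symm.trans hl) (by simp)
      rcases le_or_gt (a + D + 1) (r + 1 - D) with hle | hlt
      · obtain ⟨-, -, q, -, hq⟩ := hz.exists_mem
        exact hne (by rw [hq, hprev _ q hle (by omega), h.proposal_eq])
      -- Here the root values may differ from `y`, but `T` covers only stable rounds. Knowing `R` in
      -- the latest of them implies knowing it in the earlier ones, so `T` is a singleton.
      · obtain ⟨-, -, hR', hknown⟩ := hex.of_rootEst_eq_some hσ hest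
        obtain rfl := hR'.unique (hR _ (by omega) (by omega))
        refine absurd hcard (not_lt.2 (Finset.card_le_one_iff_subset_singleton.2
          ⟨some R', fun e he => ?_⟩))
        obtain ⟨i, hi, rfl⟩ := Finset.mem_image.1 he
        obtain ⟨-, hi1, hi2⟩ := Finset.mem_filter.1 hi
        have hmax := h.le_max.trans hi1
        rw [Finset.mem_singleton]
        exact hex.rootEst_eq_some hσ (by omega) (by omega) (hR i (by omega) (by omega))
          fun q hq => causalPast_mono hσ.1 (by omega) (by omega) le_rfl (hknown q hq)
    rcases hd with ⟨hc', -⟩ | ⟨-, ⟨-, hd⟩ | ⟨-, hd⟩⟩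
    · exact absurd hc' hc
    · rw [hd]
      exact ⟨h.proposal_eq, h.locked_eq, h.lock_le,
        h.confirmed.imp_right (Finset.mem_insert_of_mem)⟩
    · rwa [hd]

theorem IsExecution.exists_isSettled (hex : IsExecution D N x σ ρ) (hσ : σ ∈ STABLE P D (D + 1))
    (hD : 1 ≤ D) (hN : 1 ≤ N) : ∃ r₀ y, ∀ r, r₀ ≤ r → ∀ p, IsSettled r₀ y (ρ r p).vars := by
  obtain ⟨⟨hroot, hstab⟩, hdiam⟩ := hσ
  obtain ⟨R, a, hR, ha⟩ := exists_stable_period hstab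
  have hR₁ := hR (a + 1) le_rfl (by omega)
  -- `DIAM` is applied to rounds `a + 2, …, a + D + 1`: the root of round `a + 1` must be formed
  -- first, which is why `D + 1` stable rounds are needed.
  have hknown : ∀ p, ∀ q ∈ R, q ∈ CausalPast σ p (a + 1) (a + D + 1) := by
    have h := hdiam.2 (a + 1) R ⟨by omega, fun r h1 h2 => hR r (by omega) (by omega)⟩
    rwa [show a + 1 + D = a + D + 1 by omega] at h
  obtain ⟨y, hy⟩ : ∃ y, IsRootValue σ ρ (a + 1) y := ⟨_, by omega, R, hR₁.1.1, hR₁, rfl⟩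
  refine ⟨a + D + 1, y, fun r hr => ?_⟩
  induction r using Nat.strong_induction_on with
  | _ r ih =>
    intro p
    rcases hr.eq_or_lt with rfl | hlt
    · exact (hex.isSettled_detect hroot hD hN hR₁ ha hy p (hknown p)).rest_of_round hex hroot hN
        (fun s q h1 h2 => absurd h1 (by omega))
    · obtain ⟨t, rfl⟩ : ∃ t, r = t + 1 := ⟨r - 1, by omega⟩
      exact ((ih t (by omega) (by omega) p).detect hex hroot hD hR (by omega)
        (fun s q h1 h2 => (ih s h2 h1 q).proposal_eq)).rest_of_round hex hroot hN
        (fun s q h1 h2 => ⟨(ih s h2 h1 q).locked_eq, (ih s h2 h1 q).proposal_eq⟩)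

theorem IsExecution.exists_decision (hex : IsExecution D N x σ ρ) (hσ : σ ∈ STABLE P D (D + 1))
    (hD : 1 ≤ D) (hN : 1 ≤ N) (p : P) : ∃ r y, (ρ r p).vars.decision = some y := by
  obtain ⟨r₀, y, hset⟩ := hex.exists_isSettled hσ hD hN
  -- Late enough for the decision window to start after `r₀` and for the waiting time since the lock
  -- round to have passed.
  obtain ⟨r, hr⟩ : ∃ r, r = r₀ + N * (D + 2 * N) + (D + 2 * N) ^ 2 := ⟨_, rfl⟩
  refine ⟨r + 1, ?_⟩
  rw [← Option.isSome_iff_exists]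
  have hfin := hset (r + 1) (by omega) p
  rw [hex.step] at hfin ⊢
  generalize adopt N (view σ ρ (r + 1) p) (r + 1) (backoff N (view σ ρ (r + 1) p) (r + 1)
      (ConsensusAlg.detect D (view σ ρ (r + 1) p) (r + 1) (ρ r p).vars)) = w at hfin ⊢
  rcases decideNow_cases D N (view σ ρ (r + 1) p) (r + 1) w with ⟨hc, hd⟩ | ⟨-, hd⟩
  · rw [hd] at hfin ⊢
    by_contra hnone
    have := hfin.lock_le
    refine hc ⟨by simpa using hnone, by omega, fun q s z hz => ?_⟩
    obtain ⟨-, h1, ⟨h2, -⟩, rfl⟩ := mem_knownStates_view.1 hz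
    have hs := hset s (by omega) q
    exact ⟨hs.locked_eq, hs.proposal_eq.trans hfin.proposal_eq.symm⟩
  · rw [hd]; rfl

end Termination

end ConsensusAlg

namespace ConsensusAlg

/-! ### Agreement -/

section Agreement

variable {P : Type u} {V : Type v} [Fintype P]
  {D N : ℕ} {x : P → V} {σ : ℕ → Digraph P} {ρ : ℕ → P → Record P V} {a : ℕ} {C : Finset P} {v : V}

/-- In the `D + 2 * N` rounds after round `a`, no message enters the set `C`, whose members are
locked on `v` during this time. -/
structure IsCore (D N : ℕ) (σ : ℕ → Digraph P) (ρ : ℕ → P → Record P V) (a : ℕ) (C : Finset P)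
    (v : V) : Prop where
  nonempty : C.Nonempty
  isInClosed : ∀ s, a < s → s ≤ a + (D + 2 * N) → IsInClosed (σ s) C
  locked_eq : ∀ s, a ≤ s → s < a + (D + 2 * N) → ∀ q ∈ C, (ρ s q).vars.locked = true
  proposal_eq : ∀ s, a ≤ s → s < a + (D + 2 * N) → ∀ q ∈ C, (ρ s q).vars.proposal = v

theorem IsCore.exists_mem_knownStates (h : IsCore D N σ ρ a C v) (hσ : σ ∈ ROOTED P)
    (hN : Fintype.card P ≤ N) (hN₁ : 1 ≤ N) {r : ℕ} (h1 : a + N ≤ r) (h2 : r ≤ a + (D + 2 * N))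
    (p : P) : ∃ q z, (q, r - N, z) ∈ knownStates (view σ ρ r p) r N N ∧
      z.locked = true ∧ z.proposal = v := by
  obtain ⟨c, hc⟩ := h.nonempty
  obtain ⟨u, hup, huc⟩ := exists_mem_causalPast_inter hσ hN p c (r := r) (by omega)
  have hu : u ∈ C := causalPast_subset_of_isInClosed (by omega)
    (fun s h3 h4 => h.isInClosed s (by omega) (by omega)) hc huc
  exact ⟨u, _, mem_knownStates_view.2 ⟨⟨by omega, hup⟩, le_rfl, ⟨by omega, hup⟩, rfl⟩,
    h.locked_eq _ (by omega) (by omega) u hu, h.proposal_eq _ (by omega) (by omega) u hu⟩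

variable [LinearOrder V]

theorem IsCore.eq_of_isRootValue (h : IsCore D N σ ρ a C v) {s : ℕ} (h1 : a < s)
    (h2 : s < a + (D + 2 * N)) {y : V} (hy : IsRootValue σ ρ s y) : y = v := by
  obtain ⟨R, hR, q, hq, rfl⟩ := hy.exists_mem
  exact h.proposal_eq s h1.le h2 q (hR.subset (h.isInClosed s h1 h2.le) h.nonempty hq)

/-- The lock round refers to the root value of a round after `a`, and roots in the block lie in `C`.
-/
theorem IsCore.eq_of_lockRound (h : IsCore D N σ ρ a C v) (hD : 1 ≤ D) {r : ℕ} {w : Vars V}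
    (hw : IsConsistent D N σ ρ r w) (hr : r ≤ a + (D + 2 * N)) (hlt : a + D < w.lockRound)
    (hl : w.locked = true ∨ r < w.lockRound + 2 * N) : w.proposal = v := by
  have := hw.lock_le
  exact h.eq_of_isRootValue (by omega) (by omega) (hw.lock_value hl (by omega))

/-- All processes that are still locked on another value after `D + N` rounds become unlocked. -/
theorem IsCore.eq_of_locked (h : IsCore D N σ ρ a C v) (hex : IsExecution D N x σ ρ)
    (hσ : σ ∈ ROOTED P) (hD : 1 ≤ D) (hN : Fintype.card P ≤ N) (hN₁ : 1 ≤ N) {r : ℕ} {p : P}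
    (h1 : a + D + N ≤ r) (h2 : r ≤ a + (D + 2 * N)) (hl : (ρ r p).vars.locked = true) :
    (ρ r p).vars.proposal = v := by
  obtain ⟨t, rfl⟩ : ∃ t, r = t + 1 := ⟨r - 1, by omega⟩
  by_contra hne
  refine hne (h.eq_of_lockRound hD (hex.isConsistent hσ hD hN₁ (t + 1) p) h2 ?_ (.inl hl))
  obtain ⟨q, z, hz, -, hzv⟩ := h.exists_mem_knownStates hσ hN hN₁ (r := t + 1) (by omega) h2 p
  rw [hex.step, locked_decideNow, locked_adopt] at hl
  rw [hex.step, proposal_decideNow, hex.adopt_of_locked hσ hN₁ hl, proposal_backoff] at hne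
  rw [hex.step, lockRound_decideNow, lockRound_adopt]
  generalize detect D (view σ ρ (t + 1) p) (t + 1) (ρ t p).vars = w at *
  have hev : t + 1 - N ∈ evidence N (view σ ρ (t + 1) p) (t + 1) w :=
    ⟨q, z, hz, .inr (by rwa [hzv])⟩
  rcases backoff_cases N (view σ ρ (t + 1) p) (t + 1) w with
    ⟨hc, hb⟩ | ⟨-, -, Q, hQ, ⟨m, hm, -, hb⟩ | ⟨-, hb⟩⟩
  · rw [hb]
    -- With a lock round at most `a + D`, the waiting time `N` would be over and the state heard
    -- from `C` would force a back-off.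
    by_contra
    exact hc ⟨by omega, _, hev⟩
  · rw [hb]
    have := ((hQ m).1 hm).2 _ hev
    change a + D < m
    omega
  · rw [hb] at hl
    simp at hl

/-- At the end of the `D + 2 * N` rounds, all processes have adopted the proposal. -/
theorem IsCore.eq_of_last (h : IsCore D N σ ρ a C v) (hex : IsExecution D N x σ ρ)
    (hσ : σ ∈ ROOTED P) (hD : 1 ≤ D) (hN : Fintype.card P ≤ N) (hN₁ : 1 ≤ N) (p : P) :
    (ρ (a + (D + 2 * N)) p).vars.proposal = v := by
  by_cases hlt : a + D < (ρ (a + (D + 2 * N)) p).vars.lockRound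
  · exact h.eq_of_lockRound hD (hex.isConsistent hσ hD hN₁ _ p) le_rfl hlt (.inr (by omega))
  obtain ⟨r, hr⟩ : ∃ r, a + (D + 2 * N) = r + 1 := ⟨a + (D + 2 * N) - 1, by omega⟩
  obtain ⟨q, z, hz, hzl, hzv⟩ := h.exists_mem_knownStates hσ hN hN₁ (r := r + 1) (by omega)
    (by omega) p
  -- The last `N` rounds of the block start at `a + D + N`, from where locked processes propose `v`;
  -- one locked state comes from `C`.
  have hS : lockedProposals N (view σ ρ (r + 1) p) (r + 1) = {v} := by
    refine Set.eq_singleton_iff_unique_mem.2 ⟨⟨q, _, z, hz, hzl, hzv⟩, ?_⟩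
    rintro y ⟨q', s, z', hz', hzl', rfl⟩
    obtain ⟨-, hs, ⟨hs', -⟩, rfl⟩ := mem_knownStates_view.1 hz'
    exact h.eq_of_locked hex hσ hD hN hN₁ (by omega) (by omega) hzl'
  rw [hr, hex.step, lockRound_decideNow, lockRound_adopt] at hlt
  rw [hr, hex.step, proposal_decideNow]
  rcases adopt_cases N (view σ ρ (r + 1) p) (r + 1) (backoff N (view σ ρ (r + 1) p) (r + 1)
    (detect D (view σ ρ (r + 1) p) (r + 1) (ρ r p).vars)) with ⟨hc, ha⟩ | ⟨-, y, hy, -, ha⟩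
  · rw [ha]
    by_contra hne
    exact hc ⟨by omega, v, hS, fun heq => hne heq.symm⟩
  · rw [ha]
    exact Set.singleton_injective (hy.symm.trans hS)

/-- New proposals come from roots after round `a` or from locked states of rounds after `a + D + N`,
and both sources yield only `v`. -/
theorem IsCore.eq_of_le (h : IsCore D N σ ρ a C v) (hex : IsExecution D N x σ ρ)
    (hσ : σ ∈ ROOTED P) (hD : 1 ≤ D) (hN : Fintype.card P ≤ N) (hN₁ : 1 ≤ N) (r : ℕ)
    (hr : a + (D + 2 * N) ≤ r) : ∀ p, (ρ r p).vars.proposal = v := by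
  induction r using Nat.strong_induction_on with
  | _ r ih =>
    intro p
    rcases hr.eq_or_lt with rfl | hlt
    · exact h.eq_of_last hex hσ hD hN hN₁ p
    obtain ⟨t, rfl⟩ : ∃ t, r = t + 1 := ⟨r - 1, by omega⟩
    rw [hex.step, proposal_decideNow]
    rcases adopt_cases N (view σ ρ (t + 1) p) (t + 1) (backoff N (view σ ρ (t + 1) p) (t + 1)
      (detect D (view σ ρ (t + 1) p) (t + 1) (ρ t p).vars)) with ⟨-, ha⟩ | ⟨-, y, hy, -, ha⟩
    · rw [ha, proposal_backoff]
      rcases hex.detect_cases hσ (t + 1) p (ρ t p).vars with hd | ⟨y, -, hy, hd | ⟨-, -, hd⟩⟩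
      · rw [hd]
        exact ih t (by omega) (by omega) p
      · rw [hd]
        rcases lt_or_ge (t + 1 - D) (a + (D + 2 * N)) with hs | hs
        · exact h.eq_of_isRootValue (by omega) hs hy
        · obtain ⟨-, -, q, -, rfl⟩ := hy.exists_mem
          exact ih _ (by omega) hs q
      · rw [hd]
        exact ih t (by omega) (by omega) p
    · rw [ha]
      obtain ⟨q, s, z, hz, hzl, rfl⟩ : y ∈ lockedProposals N (view σ ρ (t + 1) p) (t + 1) := by
        rw [hy]; rfl
      obtain ⟨-, hs, ⟨hs', -⟩, rfl⟩ := mem_knownStates_view.1 hz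
      rcases le_or_gt s (a + (D + 2 * N)) with hle | hgt
      · exact h.eq_of_locked hex hσ hD hN hN₁ (by omega) hle hzl
      · exact ih s hs' hgt.le q

/-- When a process decides, its proposal is and remains the proposal of all processes. -/
theorem IsExecution.eq_of_decision (hex : IsExecution D N x σ ρ) (hσ : σ ∈ ROOTED P)
    (hD : 1 ≤ D) (hN : Fintype.card P ≤ N) (hN₁ : 1 ≤ N) {r : ℕ} {p : P} {y : V}
    (hy : (ρ r p).vars.decision = some y) :
    ∃ t, ∀ s, t ≤ s → ∀ q, (ρ s q).vars.proposal = y := by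
  induction r with
  | zero => rw [hex.init] at hy; simp at hy
  | succ r ih =>
    rcases hex.decision_succ hσ r p with hd | ⟨-, hd, hlock, hS⟩
    · exact ih (hd ▸ hy)
    · obtain rfl := Option.some.inj (hd.symm.trans hy)
      have hpos := (hex.isConsistent hσ hD hN₁ (r + 1) p).lock_pos
      obtain ⟨a, C, hne, ha, har, hcl, hknown⟩ := exists_constant_causalPast hσ.1 hN p
        (r := r + 1) (M := D + 2 * N) (by omega)
      -- The window of states checked at the decision thus contains the whole block found by
      -- pigeonhole.
      have hM : N * (D + 2 * N) ≤ (D + 2 * N) ^ 2 := by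
        rw [sq]; exact Nat.mul_le_mul_right _ (by omega)
      have hM₁ : 1 ≤ N * (D + 2 * N) := Nat.mul_pos hN₁ (by omega)
      have hloc : ∀ s, a ≤ s → s < a + (D + 2 * N) → ∀ q ∈ C, (ρ s q).vars.locked = true ∧
          (ρ s q).vars.proposal = (ρ (r + 1) p).vars.proposal := fun s h1 h2 q hq =>
        hS q s (causalPast_mono hσ.1 (by omega) (by omega) le_rfl (hknown s h1 h2.le q hq))
          (by omega) (by omega) (by omega) (hknown s h1 h2.le q hq)
      have hcore : IsCore D N σ ρ a C (ρ (r + 1) p).vars.proposal :=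
        ⟨hne, hcl, fun s h1 h2 q hq => (hloc s h1 h2 q hq).1,
          fun s h1 h2 q hq => (hloc s h1 h2 q hq).2⟩
      exact ⟨_, hcore.eq_of_le hex hσ hD hN hN₁⟩

theorem IsExecution.exists_input_of_decision (hex : IsExecution D N x σ ρ) (hσ : σ ∈ ROOTED P)
    (hD : 1 ≤ D) {r : ℕ} {p : P} {y : V} (hy : (ρ r p).vars.decision = some y) :
    ∃ q, x q = y := by
  induction r with
  | zero => rw [hex.init] at hy; simp at hy
  | succ r ih =>
    rcases hex.decision_succ hσ r p with hd | ⟨-, hd, -, -⟩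
    · exact ih (hd ▸ hy)
    · obtain rfl := Option.some.inj (hd.symm.trans hy)
      exact hex.exists_input hσ hD (r + 1) p

theorem IsExecution.decision_of_le (hex : IsExecution D N x σ ρ) (hσ : σ ∈ ROOTED P) {r t : ℕ}
    (hrt : r ≤ t) {p : P} {y : V} (hy : (ρ r p).vars.decision = some y) :
    (ρ t p).vars.decision = some y := by
  induction t, hrt using Nat.le_induction with
  | base => exact hy
  | succ t _ ih =>
    rcases hex.decision_succ hσ t p with hd | ⟨hnone, -⟩
    · rw [hd, ih]
    · rw [ih] at hnone
      simp at hnone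

end Agreement

end ConsensusAlg

theorem mainTheorem1 {P : Type u} [Fintype P] {V : Type v} [LinearOrder V] (D N : ℕ)
    (hD : 1 ≤ D) (hN : Fintype.card P ≤ N) :
    (consensusAlgorithm P V D N).SolvesConsensus (STABLE P D (D + 1)) := by
  intro x σ hσ
  have hroot : σ ∈ ROOTED P := hσ.1.1
  have hex := ConsensusAlg.isExecution_record (D := D) (N := N) (x := x) hroot.1
  -- `N = 0` is possible if there are no processes, but each claim below comes with a process.
  have hN₁ : P → 1 ≤ N := fun p => (Fintype.card_pos_iff.2 ⟨p⟩).trans_le hN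
  refine ⟨fun p => hex.exists_decision hσ hD (hN₁ p) p, fun p r r' y hrr' hy => ?_,
    fun p q r r' y z hy hz => ?_, fun p r y hy => ?_⟩
  · exact hex.decision_of_le hroot hrr' hy
  · obtain ⟨t, ht⟩ := hex.eq_of_decision hroot hD hN (hN₁ p) hy
    obtain ⟨t', ht'⟩ := hex.eq_of_decision hroot hD hN (hN₁ p) hz
    -- Both decisions are eventually the proposal of the same process `p` in a common round.
    exact (ht _ (le_max_left t t') p).symm.trans (ht' _ (le_max_right t t') p)
  · exact hex.exists_input_of_decision hroot hD hy
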